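/- A domain is a nonempty connected open set. For an open set $U\subset\mathbb C$, a map $f:U\to\mathbb R^n$ is conformal harmonic (possibly with branch points) if it is harmonic and $|f_x|=|f_y|$, $f_x\cdot f_y=0$ on $U$. For a domain $\Omega\subset\mathbb R^n$, $n\ge 3$, with $\mathbb D=\{|z|<1\}$, the minimal pseudometric is $$g_\Omega(p,v)=\inf\{1/r : r>0,\ \exists f:\mathbb D\to\Omega \text{ conformal harmonic},\ f(0)=p,\ f_x(0)=rv\},$$ and the minimal pseudodistance $\mathrm{dist}_\Omega(p,q)$ is the infimum of $\int_0^1 g_\Omega(\gamma(t),\gamma'(t))\,dt$ over piecewise $C^1$ paths $\gamma:[0,1]\to\Omega$ from $p$ to $q$. The domain $\Omega$ is hyperbolic if $\mathrm{dist}_\Omega$ is a distance (that is, $\mathrm{dist}_\Omega(p,q)=0$ only if $p=q$), and weakly hyperbolic if every conformal harmonic map $\mathbb C\to\Omega$ is constant. A minimal surface in $\Omega$ is a smooth immersion $f:R\to\Omega$ of a connected smooth surface $R$ with vanishing mean curvature; it is proper if $f$ is proper as a map into $\Omega$. It is parabolic if, in the Riemannian metric induced by $f$, every negative subharmonic function on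 $R$ is constant; a plane domain is parabolic if this holds for its flat metric. For a domain $D\subset\mathbb C=\mathbb R^2$ put $$\Omega_D=\{(x,y,z)\in\mathbb R^3: |z|<1,\ z^2(x^2+y^2)<1,\ (x,y)\in D \text{ if } z=0\}.$$ (a) There is a nonhyperbolic domain in $\mathbb R^3$ which does not contain any parabolic minimal surface. (b) In particular, there is a weakly hyperbolic domain in $\mathbb R^3$ which is not hyperbolic. (c) For every parabolic domain $D\subsetneq\mathbb C$ which omits at least two points of $\mathbb C$, the set $\Omega_D\subset\mathbb R^3$ is a weakly hyperbolic, nonhyperbolic domain which contains $D\times\{0\}$ as a proper minimal surface. -/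

import Mathlib

open Set MeasureTheory
open scoped ENNReal ContDiff Manifold Topology RealInnerProductSpace

universe u

namespace MinimalSurfaces

noncomputable section

/-! ### Domains and conformal harmonic maps from plane domains -/

/-- A domain: a nonempty connected open set. -/
def IsDomainSet {X : Type*} [TopologicalSpace X] (U : Set X) : Prop :=
  IsOpen U ∧ IsConnected U

/-- The coordinate basis of the plane `ℂ = ℝ²`. -/
def planeBasis : Fin 2 → ℂ := ![1, Complex.I]

/-- The partial derivative `∂F/∂xᵢ` of a map defined on (part of) the plane `ℂ = ℝ²`. -/
def pderiv {E : Type*} [NormedAddCommGroup E] [NormedSpace ℝ E]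
    (i : Fin 2) (F : ℂ → E) (x : ℂ) : E :=
  fderiv ℝ F x (planeBasis i)

/-- `f` is a conformal harmonic map on the open set `U ⊆ ℂ`, possibly with branch points:
`f` is harmonic, `|f_x| = |f_y|` and `f_x · f_y = 0` on `U`. Constant maps are included. -/
def IsConformalHarmonicOn {E : Type*} [NormedAddCommGroup E] [InnerProductSpace ℝ E]
    (f : ℂ → E) (U : Set ℂ) : Prop :=
  InnerProductSpace.HarmonicOnNhd f U ∧
    ∀ z ∈ U, ‖pderiv 0 f z‖ = ‖pderiv 1 f z‖ ∧ ⟪pderiv 0 f z, pderiv 1 f z⟫ = 0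

/-! ### The minimal pseudometric, the minimal pseudodistance, hyperbolicity -/

/-- The minimal pseudometric `g_Ω(p, v)`: the infimum of `1/r`, `r > 0`, over all conformal
harmonic discs `f : 𝔻 → Ω` with `f(0) = p` and `f_x(0) = r v`. -/
def minimalPseudometric {n : ℕ} (Ω : Set (EuclideanSpace ℝ (Fin n)))
    (p v : EuclideanSpace ℝ (Fin n)) : ℝ≥0∞ :=
  ⨅ (r : ℝ) (f : ℂ → EuclideanSpace ℝ (Fin n))
    (_ : 0 < r ∧ IsConformalHarmonicOn f (Metric.ball 0 1) ∧ MapsTo f (Metric.ball 0 1) Ω ∧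
      f 0 = p ∧ pderiv 0 f 0 = r • v), ENNReal.ofReal (1 / r)

/-- `γ` is piecewise continuously differentiable on `[0,1]`: there is a partition
`0 = t₀ ≤ t₁ ≤ ⋯ ≤ t_N = 1` such that `γ` is `C¹` on each closed interval `[tᵢ, tᵢ₊₁]`
(in particular `γ` is continuous on `[0,1]`). -/
def IsPiecewiseC1 {E : Type*} [NormedAddCommGroup E] [NormedSpace ℝ E] (γ : ℝ → E) : Prop :=
  ∃ (N : ℕ) (t : ℕ → ℝ), Monotone t ∧ t 0 = 0 ∧ t N = 1 ∧
    ∀ i < N, ContDiffOn ℝ 1 γ (Icc (t i) (t (i + 1)))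

/-- The minimal pseudodistance, obtained by integrating the minimal pseudometric: the infimum
of `∫₀¹ g_Ω(γ(t), γ'(t)) dt` over all piecewise `C¹` paths `γ` in `Ω` from `p` to `q`. -/
def minimalDist {n : ℕ} (Ω : Set (EuclideanSpace ℝ (Fin n)))
    (p q : EuclideanSpace ℝ (Fin n)) : ℝ≥0∞ :=
  ⨅ (γ : ℝ → EuclideanSpace ℝ (Fin n))
    (_ : IsPiecewiseC1 γ ∧ MapsTo γ (Icc 0 1) Ω ∧ γ 0 = p ∧ γ 1 = q),
    ∫⁻ t in Icc (0 : ℝ) 1, minimalPseudometric Ω (γ t) (deriv γ t)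

/-- `Ω` is hyperbolic: the minimal pseudodistance is a distance, i.e. it separates points. -/
def IsHyperbolic {n : ℕ} (Ω : Set (EuclideanSpace ℝ (Fin n))) : Prop :=
  ∀ p ∈ Ω, ∀ q ∈ Ω, minimalDist Ω p q = 0 → p = q

/-- `Ω` is weakly hyperbolic: every conformal harmonic map `ℂ → Ω` is constant. -/
def IsWeaklyHyperbolic {n : ℕ} (Ω : Set (EuclideanSpace ℝ (Fin n))) : Prop :=
  ∀ f : ℂ → EuclideanSpace ℝ (Fin n), IsConformalHarmonicOn f univ → (∀ z, f z ∈ Ω) →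
    ∃ c, ∀ z, f z = c

/-! ### Immersed surfaces

A surface is a smooth real 2-manifold without boundary, with charts in the real plane
`ℂ = ℝ²`. The transition maps are real smooth, so no complex or conformal structure on the
surface and no orientation is involved. -/

/-- The first fundamental form `gᵢⱼ = ⟨∂ᵢF, ∂ⱼF⟩` of a parametrized surface `F`. -/
def firstForm {E : Type*} [NormedAddCommGroup E] [InnerProductSpace ℝ E]
    (F : ℂ → E) (x : ℂ) : Matrix (Fin 2) (Fin 2) ℝ :=
  Matrix.of fun i j => ⟪pderiv i F x, pderiv j F x⟫

/-- The Laplace-Beltrami operator of the metric `g` in coordinates,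
`Δ_g u = (det g)^(-1/2) ∑ᵢ ∂ᵢ((det g)^(1/2) ∑ⱼ gⁱʲ ∂ⱼu)`. -/
def laplaceBeltrami (g : ℂ → Matrix (Fin 2) (Fin 2) ℝ) (u : ℂ → ℝ) (x : ℂ) : ℝ :=
  (Real.sqrt (g x).det)⁻¹ *
    ∑ i, pderiv i (fun y => Real.sqrt (g y).det * ∑ j, (g y)⁻¹ i j * pderiv j u y) x

/-- The mean curvature vector of the parametrized surface `F` vanishes at `x`: the trace
`∑ᵢⱼ gⁱʲ ⟨∂ᵢ∂ⱼF, N⟩` of the second fundamental form vanishes for all normal vectors `N`. -/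
def MeanCurvatureVanishesAt {E : Type*} [NormedAddCommGroup E] [InnerProductSpace ℝ E]
    (F : ℂ → E) (x : ℂ) : Prop :=
  ∀ N : E, (∀ i, ⟪pderiv i F x, N⟫ = 0) →
    ∑ i, ∑ j, (firstForm F x)⁻¹ i j * ⟪pderiv i (pderiv j F) x, N⟫ = 0

section Surface

variable {R : Type*} [TopologicalSpace R] [ChartedSpace ℂ R]
  {E : Type*} [NormedAddCommGroup E] [InnerProductSpace ℝ E]

/-- A map on a surface, read in the chart at `p`. -/
def inChart {X : Type*} (p : R) (h : R → X) : ℂ → X := fun x => h ((chartAt ℂ p).symm x)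

/-- The Laplacian of `u : R → ℝ` at `p` in the Riemannian metric induced on `R` by the
immersion `f : R → E` (computed in the chart at `p`; the value does not depend on the
chart). -/
def inducedLaplacian (f : R → E) (u : R → ℝ) (p : R) : ℝ :=
  laplaceBeltrami (firstForm (inChart p f)) (inChart p u) (chartAt ℂ p p)

/-- `f : R → E` is a smooth minimal immersion: its differential is injective and its mean
curvature vanishes everywhere. -/
structure IsMinimalImmersion (f : R → E) : Prop where
  smooth : ContMDiff 𝓘(ℝ, ℂ) 𝓘(ℝ, E) ∞ f
  immersion : ∀ p, Function.Injective (mfderiv 𝓘(ℝ, ℂ) 𝓘(ℝ, E) f p)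
  minimal : ∀ p, MeanCurvatureVanishesAt (inChart p f) (chartAt ℂ p p)

/-- The (connected) surface `R`, with the Riemannian metric induced by the immersion
`f : R → E`, is parabolic: every negative subharmonic function on `R` is constant. -/
def IsParabolicImmersion (f : R → E) : Prop :=
  ∀ u : R → ℝ, ContMDiff 𝓘(ℝ, ℂ) 𝓘(ℝ, ℝ) 2 u → (∀ p, u p < 0) →
    (∀ p, 0 ≤ inducedLaplacian f u p) → ∃ c, ∀ p, u p = c

/-- `f : R → Ω` is a proper minimal surface in `Ω`: a minimal immersion with values in `Ω`
which is proper as a map into `Ω`. -/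
def IsProperMinimalSurfaceIn (f : R → E) (Ω : Set E) : Prop :=
  IsMinimalImmersion f ∧ ∃ h : ∀ p, f p ∈ Ω, IsProperMap (fun p => (⟨f p, h p⟩ : Ω))

end Surface

/-- `Ω` contains an immersed (not necessarily proper, complete, embedded or orientable)
parabolic minimal surface. -/
def ContainsParabolicMinimalSurface {n : ℕ} (Ω : Set (EuclideanSpace ℝ (Fin n))) : Prop :=
  ∃ (R : Type u) (_ : TopologicalSpace R) (_ : T2Space R) (_ : SecondCountableTopology R)
    (_ : ConnectedSpace R) (_ : ChartedSpace ℂ R) (_ : IsManifold 𝓘(ℝ, ℂ) ∞ R)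
    (f : R → EuclideanSpace ℝ (Fin n)),
    IsMinimalImmersion f ∧ IsParabolicImmersion f ∧ ∀ p, f p ∈ Ω

/-- A plane domain is parabolic if it is parabolic in its flat metric, the one induced by the
inclusion in `ℂ = ℝ²`. -/
def IsParabolicPlaneDomain (D : TopologicalSpace.Opens ℂ) : Prop :=
  IsConnected (D : Set ℂ) ∧ IsParabolicImmersion (fun z : D => (z : ℂ))

/-! ### The domains `Ω_D` -/

/-- The inclusion `D → D × {0} ⊆ ℝ³`. -/
def horizontalInclusion (D : TopologicalSpace.Opens ℂ) (z : D) : EuclideanSpace ℝ (Fin 3) :=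
  !₂[(z : ℂ).re, (z : ℂ).im, 0]

/-- `Ω_D = {(x,y,z) : |z| < 1, z²(x²+y²) < 1, (x,y) ∈ D if z = 0}`. -/
def Omega (D : TopologicalSpace.Opens ℂ) : Set (EuclideanSpace ℝ (Fin 3)) :=
  {p | |p 2| < 1 ∧ p 2 ^ 2 * (p 0 ^ 2 + p 1 ^ 2) < 1 ∧ (p 2 = 0 → (⟨p 0, p 1⟩ : ℂ) ∈ D)}

end

end MinimalSurfaces

open MinimalSurfaces

/-! The slice of `Omega D` at height `c ≠ 0` lies in a disc of radius `1 / |c|`, and the slice at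
height `0` is `D`. Since the height is bounded, Liouville makes it constant along a conformal
harmonic map from `ℂ`. At nonzero height the other two coordinates are bounded, hence constant too.
At height `0` the map is a planar conformal harmonic map into `D`, so it or its conjugate is entire
and omits two values, and little Picard applies (`isWeaklyHyperbolic_Omega`). Picard is derived here
from Bloch's theorem by two successive arccosines.

Hyperbolicity fails because horizontal slices near the plane `z = 0` contain huge discs. To join two
nearby points of `D × {0}`, rise to height `ε`, move horizontally, and descend. The vertical legs
have length `ε` and lie in discs of fixed radius, while the horizontal leg lies in discs of radius
`1 / (2 ε)`. The cost is therefore `O(ε)`, so the two points are at pseudodistance zero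
(`not_isHyperbolic_Omega`).

On a minimal surface, linear coordinates are harmonic for the induced metric
(`laplaceBeltrami_firstForm_eq_zero`), so on a parabolic one every coordinate bounded above is
constant. For bounded `D`, the slicing argument then makes all three coordinates constant, which no
immersion allows. The unit disc serves as `D` for both existence statements. -/

/-! ### Bloch's theorem and the little Picard theorem -/

open Complex Metric in
/-- If `‖G'‖ ≤ 2 ‖G' a‖` on the disc of radius `t` about `a`, then the image of `G` contains
a disc of radius `‖G' a‖ * t / 32`. -/
theorem exists_ball_subset_range_of_norm_deriv_le {G : ℂ → ℂ} (hG : Differentiable ℂ G)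
    {a : ℂ} {t : ℝ} (ht : 0 < t) (ha : deriv G a ≠ 0)
    (hb : ∀ z ∈ ball a t, ‖deriv G z‖ ≤ 2 * ‖deriv G a‖) :
    ball (G a) (‖deriv G a‖ * t / 32) ⊆ range G := by
  set m := ‖deriv G a‖ with hm
  have hm0 : 0 < m := norm_pos_iff.2 ha
  have hG' : Differentiable ℂ (deriv G) := fun z =>
    ((hG.analyticAt z).deriv).differentiableAt
  have h1 : ∀ z ∈ ball a t, ‖deriv G z - deriv G a‖ ≤ 4 * m / t * ‖z - a‖ := by
    intro z hz
    -- Schwarz's lemma for `deriv G`: its values differ from `deriv G a` by at most `2 m + m`, so a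
    -- target disc of radius `4 m` is ample.
    have := dist_le_div_mul_dist_of_mapsTo_ball (f := deriv G) (c := a) (R₁ := t) (R₂ := 4 * m)
      (z := z) hG'.differentiableOn (by
        intro w hw
        have := hb w hw
        have h2 := norm_sub_le (deriv G w) (deriv G a)
        simp only [mem_closedBall, dist_eq_norm]
        linarith) hz
    simpa [dist_eq_norm] using this
  have hs : 0 < t / 8 := by positivity
  -- On this circle the linear term of `G` has size `m t / 8` and the remainder is at most `m t /
  -- 16`. The quantitative open mapping theorem used below halves the resulting lower bound, whence
  -- the `32`.
  have h2 : ∀ z ∈ sphere a (t / 8), m * t / 16 ≤ ‖G z - G a‖ := by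
    intro z hz
    have hz' : ‖z - a‖ = t / 8 := by simpa [dist_eq_norm] using hz
    have hsub : closedBall a (t / 8) ⊆ ball a t := closedBall_subset_ball (by linarith)
    have h3 := (convex_closedBall a (t / 8)).norm_image_sub_le_of_norm_hasDerivWithin_le
      (f := fun w => G w - deriv G a * w) (f' := fun w => deriv G w - deriv G a)
      (C := 4 * m / t * (t / 8)) (x := a) (y := z)
      (fun w _ => by
        have := ((hG w).hasDerivAt.sub ((hasDerivAt_id w).const_mul (deriv G a)))
        rw [mul_one] at this
        exact this.hasDerivWithinAt)
      (fun w hw => (h1 w (hsub hw)).trans (by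
        have : ‖w - a‖ ≤ t / 8 := by simpa [dist_eq_norm] using hw
        gcongr))
      (mem_closedBall_self hs.le) (sphere_subset_closedBall hz)
    have h4 : G z - G a = deriv G a * (z - a) +
      ((G z - deriv G a * z) - (G a - deriv G a * a)) := by ring
    have h5 : ‖deriv G a * (z - a)‖ = m * (t / 8) := by rw [norm_mul, hz']
    rw [hz'] at h3
    have h6 : 4 * m / t * (t / 8) * (t / 8) = m * t / 16 := by field_simp; ring
    rw [h6] at h3
    have h7 := norm_sub_le_norm_add (deriv G a * (z - a))
      ((G z - deriv G a * z) - (G a - deriv G a * a))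
    rw [h4]
    linarith
  have h3 := (hG.diffContOnCl (s := ball a (t / 8))).ball_subset_image_closedBall hs h2 (by
    intro hev
    have : ∀ᶠ z in 𝓝 a, G z = G a := hev.mono fun _ h => not_not.1 h
    have h8 : deriv G a = 0 := by
      rw [Filter.EventuallyEq.deriv_eq (f := fun _ => G a) this]; simp
    exact ha h8)
  refine subset_trans ?_ (h3.trans (image_subset_range _ _))
  exact ball_subset_ball (by linarith)

open Complex Metric in
/-- Bloch's theorem for entire functions: the image of a nonconstant entire function contains
discs of arbitrarily large radius. -/
theorem exists_ball_subset_range_of_deriv_ne_zero {G : ℂ → ℂ} (hG : Differentiable ℂ G)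
    {z₀ : ℂ} (h0 : deriv G z₀ ≠ 0) (ρ : ℝ) : ∃ c, ball c ρ ⊆ range G := by
  have hm0 : 0 < ‖deriv G z₀‖ := norm_pos_iff.2 h0
  set R : ℝ := 64 * (|ρ| + 1) / ‖deriv G z₀‖ with hR
  have hR0 : 0 < R := by positivity
  have hG' : Differentiable ℂ (deriv G) := fun z =>
    ((hG.analyticAt z).deriv).differentiableAt
  -- Landau's trick: where `‖G'‖` times the distance to the boundary circle is maximal, `‖G'‖` at
  -- most doubles within half that distance. The `64` in `R` is the `32` of the previous lemma times
  -- `2` for this halving.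
  obtain ⟨a, ha, hmax⟩ := (isCompact_closedBall z₀ R).exists_isMaxOn
    ⟨z₀, mem_closedBall_self hR0.le⟩
    (f := fun z => ‖deriv G z‖ * (R - ‖z - z₀‖))
    ((hG'.continuous.norm.mul (by fun_prop)).continuousOn)
  have hmax' : ∀ z ∈ closedBall z₀ R,
      ‖deriv G z‖ * (R - ‖z - z₀‖) ≤ ‖deriv G a‖ * (R - ‖a - z₀‖) := fun z hz => hmax hz
  have h1 : ‖deriv G z₀‖ * R ≤ ‖deriv G a‖ * (R - ‖a - z₀‖) := by
    simpa using hmax' z₀ (mem_closedBall_self hR0.le)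
  have h1' : 0 < ‖deriv G a‖ * (R - ‖a - z₀‖) := lt_of_lt_of_le (by positivity) h1
  have h2 : 0 < R - ‖a - z₀‖ := pos_of_mul_pos_right h1' (norm_nonneg _)
  have h3 : deriv G a ≠ 0 := by
    intro h; simp [h] at h1'
  set t := (R - ‖a - z₀‖) / 2 with ht
  have ht0 : 0 < t := by positivity
  refine ⟨G a, subset_trans (ball_subset_ball ?_)
    (exists_ball_subset_range_of_norm_deriv_le hG ht0 h3 ?_)⟩
  · have : ‖deriv G z₀‖ * R = 64 * (|ρ| + 1) := by rw [hR]; field_simp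
    have h4 := le_abs_self ρ
    have h5 : ‖deriv G a‖ * (R - ‖a - z₀‖) = 64 * (‖deriv G a‖ * t / 32) := by rw [ht]; ring
    have h6 := abs_nonneg ρ
    linarith
  · intro z hz
    have hz' : ‖z - a‖ < t := by simpa [dist_eq_norm] using hz
    have h4 : ‖z - z₀‖ ≤ ‖z - a‖ + ‖a - z₀‖ := norm_sub_le_norm_sub_add_norm_sub z a z₀
    have h5 : t ≤ R - ‖z - z₀‖ := by linarith
    have h6 := hmax' z (by simp only [mem_closedBall, dist_eq_norm]; linarith)
    have h7 : ‖deriv G z‖ * t ≤ ‖deriv G z‖ * (R - ‖z - z₀‖) := by gcongr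
    have h8 : R - ‖a - z₀‖ = 2 * t := by rw [ht]; ring
    rw [h8] at h6
    exact le_of_mul_le_mul_right (by linarith) ht0

/-- A nowhere vanishing entire function has an entire logarithm. -/
theorem exists_exp_eq_of_differentiable_of_ne_zero {g : ℂ → ℂ} (hg : Differentiable ℂ g)
    (h0 : ∀ z, g z ≠ 0) : ∃ L : ℂ → ℂ, Differentiable ℂ L ∧ ∀ z, g z = Complex.exp (L z) := by
  have hg' : Differentiable ℂ (deriv g) := fun z =>
    ((hg.analyticAt z).deriv).differentiableAt
  obtain ⟨L, hL⟩ := (hg'.div hg h0).isExactOn_univ.with_val_at 0 (Complex.log (g 0))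
  have hL' : ∀ z, HasDerivAt L (deriv g z / g z) z := fun z => hL.2 z (mem_univ z)
  refine ⟨L, fun z => (hL' z).differentiableAt, ?_⟩
  have hd : ∀ z, HasDerivAt (fun z => g z * Complex.exp (-L z)) 0 z := by
    intro z
    have := (hg z).hasDerivAt.mul (hL' z).neg.cexp
    refine this.congr_deriv ?_
    field_simp [h0 z]
    ring
  have hc := is_const_of_deriv_eq_zero (fun z => (hd z).differentiableAt) (fun z => (hd z).deriv)
  intro z
  have h1 := hc z 0
  rw [hL.1, Complex.exp_neg, Complex.exp_neg, Complex.exp_log (h0 0),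
    mul_inv_cancel₀ (h0 0)] at h1
  have := Complex.exp_ne_zero (L z)
  field_simp at h1
  exact h1

/-- An entire function omitting `1` and `-1` is the cosine of `π` times an entire function. -/
theorem exists_cos_pi_mul_eq_of_differentiable {h : ℂ → ℂ} (hh : Differentiable ℂ h)
    (h1 : ∀ z, h z ≠ 1) (h2 : ∀ z, h z ≠ -1) :
    ∃ F : ℂ → ℂ, Differentiable ℂ F ∧ ∀ z, h z = Complex.cos (Real.pi * F z) := by
  obtain ⟨L, hL, hL'⟩ := exists_exp_eq_of_differentiable_of_ne_zero (g := fun z => 1 - h z ^ 2)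
    (by fun_prop) (fun z hz => by
      have : (h z - 1) * (h z + 1) = 0 := by linear_combination -hz
      rcases mul_eq_zero.1 this with h | h
      · exact h1 z (sub_eq_zero.1 h)
      · exact h2 z (eq_neg_of_add_eq_zero_left h))
  -- `g` is a square root of `1 - h ^ 2` and plays the sine to the cosine `h`. Then `h + i g` is
  -- invertible with inverse `h - i g`, and its logarithm is `i` times the desired angle.
  set g : ℂ → ℂ := fun z => Complex.exp (L z / 2) with hg
  have hgd : Differentiable ℂ g := by fun_prop
  have hg2 : ∀ z, h z ^ 2 + g z ^ 2 = 1 := by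
    intro z
    have : g z ^ 2 = Complex.exp (L z) := by
      rw [hg]; simp only; rw [← Complex.exp_nat_mul]; congr 1; push_cast; ring
    rw [this, ← hL' z]; ring
  have hmul : ∀ z, (h z + Complex.I * g z) * (h z - Complex.I * g z) = 1 := by
    intro z
    linear_combination hg2 z - g z ^ 2 * Complex.I_sq
  obtain ⟨M, hM, hM'⟩ := exists_exp_eq_of_differentiable_of_ne_zero
    (g := fun z => h z + Complex.I * g z) (by fun_prop) (fun z hz => by
      have := hmul z
      rw [hz] at this; simp at this)
  refine ⟨fun z => M z / (Real.pi * Complex.I), by fun_prop, fun z => ?_⟩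
  have hpi : (Real.pi : ℂ) ≠ 0 := by exact_mod_cast Real.pi_ne_zero
  have e1 : (Real.pi : ℂ) * (M z / (Real.pi * Complex.I)) * Complex.I = M z := by
    field_simp
  have e2 : h z - Complex.I * g z = Complex.exp (-M z) := by
    rw [Complex.exp_neg, ← hM' z]
    exact eq_inv_of_mul_eq_one_right (hmul z)
  rw [Complex.cos, neg_mul, e1, ← hM' z, ← e2]
  ring

theorem Complex.cos_intCast_mul_pi (n : ℤ) : Complex.cos (n * Real.pi) = ((n.negOnePow : ℤ) : ℂ) := by
  have := Complex.cos_antiperiodic.add_int_mul_eq (x := 0) n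
  rwa [zero_add, Complex.cos_zero, mul_one] at this

/-- Every point of the plane is within distance less than `2` of a point at which `cos (π w)`
is an integer. -/
theorem exists_cos_pi_mul_eq_intCast (w : ℂ) :
    ∃ v ∈ Metric.ball w 2, ∃ n : ℤ, Complex.cos (Real.pi * v) = n := by
  -- At `n + i y` with `n` an integer, `cos (π ·)` equals `± cosh (π y)`. As `cosh (π y)` grows by
  -- at least `1` over a unit interval in `y ≥ 0`, it passes an integer there. Rounding the real
  -- part costs at most `1 / 2` more, so the total displacement is at most `3 / 2`.
  have key : ∀ b : ℝ, 0 ≤ b → ∃ y ∈ Icc b (b + 1), ∃ n : ℤ, Real.cosh (Real.pi * y) = n := by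
    intro b hb
    have hp := Real.pi_gt_three
    have h1 : 1 ≤ Real.cosh (Real.pi * b) := Real.one_le_cosh _
    have h2 : 2 ≤ Real.cosh Real.pi := by
      rw [Real.cosh_eq]
      have := Real.add_one_le_exp Real.pi
      have := Real.exp_pos (-Real.pi)
      linarith
    have h3 : Real.cosh (Real.pi * b) + 1 ≤ Real.cosh (Real.pi * (b + 1)) := by
      rw [mul_add, mul_one, Real.cosh_add]
      have := Real.sinh_nonneg_iff.2 (show 0 ≤ Real.pi * b by positivity)
      have := Real.sinh_nonneg_iff.2 Real.pi_pos.le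
      nlinarith [mul_nonneg ‹0 ≤ Real.sinh (Real.pi * b)› this]
    obtain ⟨y, hy, hy'⟩ := intermediate_value_Icc (show b ≤ b + 1 by linarith)
      (f := fun y => Real.cosh (Real.pi * y)) (by fun_prop)
      (show (⌈Real.cosh (Real.pi * b)⌉ : ℝ) ∈ _ from
        ⟨Int.le_ceil _, by linarith [Int.ceil_lt_add_one (Real.cosh (Real.pi * b))]⟩)
    exact ⟨y, hy, _, hy'⟩
  have key' : ∃ y : ℝ, |y - w.im| ≤ 1 ∧ ∃ n : ℤ, Real.cosh (Real.pi * y) = n := by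
    rcases le_total 0 w.im with h | h
    · obtain ⟨y, hy, hn⟩ := key _ h
      exact ⟨y, abs_le.2 ⟨by linarith [hy.1], by linarith [hy.2]⟩, hn⟩
    · obtain ⟨y, hy, n, hn⟩ := key (-w.im) (by linarith)
      exact ⟨-y, abs_le.2 ⟨by linarith [hy.2], by linarith [hy.1]⟩, n, by
        rw [mul_neg, Real.cosh_neg, hn]⟩
  obtain ⟨y, hy, n, hn⟩ := key'
  refine ⟨⟨round w.re, y⟩, ?_, ((round w.re).negOnePow : ℤ) * n, ?_⟩
  · rw [Metric.mem_ball, dist_eq_norm]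
    refine (Complex.norm_le_abs_re_add_abs_im _).trans_lt ?_
    have := abs_sub_round w.re
    rw [abs_sub_comm] at this
    simp only [Complex.sub_re, Complex.sub_im]
    linarith
  · have e : (Real.pi : ℂ) * (⟨round w.re, y⟩ : ℂ) =
        (round w.re : ℤ) * (Real.pi : ℂ) + (Real.pi * y : ℝ) * Complex.I := by
      apply Complex.ext <;> simp [mul_comm]
    rw [e, Complex.cos_add, Complex.cos_mul_I, Complex.sin_int_mul_pi, zero_mul, sub_zero,
      Complex.cos_intCast_mul_pi, ← Complex.ofReal_cosh, hn]
    push_cast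
    rfl

/-- **Little Picard theorem**, for entire functions omitting `0` and `1`. -/
theorem eq_const_of_differentiable_of_ne_zero_of_ne_one {f : ℂ → ℂ} (hf : Differentiable ℂ f)
    (h0 : ∀ z, f z ≠ 0) (h1 : ∀ z, f z ≠ 1) (z w : ℂ) : f z = f w := by
  obtain ⟨F, hF, hF'⟩ := exists_cos_pi_mul_eq_of_differentiable (h := fun z => 2 * f z - 1)
    (by fun_prop) (fun z hz => h1 z (by linear_combination hz / 2))
    (fun z hz => h0 z (by linear_combination hz / 2))
  have hFint : ∀ (z : ℂ) (n : ℤ), F z ≠ n := by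
    intro z n hn
    have h2 := hF' z
    rw [hn, mul_comm (Real.pi : ℂ), Complex.cos_intCast_mul_pi] at h2
    rcases Int.even_or_odd n with h | h
    · rw [Int.negOnePow_even _ h] at h2; push_cast at h2
      exact h1 z (by linear_combination h2 / 2)
    · rw [Int.negOnePow_odd _ h] at h2; push_cast at h2
      exact h0 z (by linear_combination h2 / 2)
  obtain ⟨G, hG, hG'⟩ := exists_cos_pi_mul_eq_of_differentiable hF
    (fun z => by simpa using hFint z 1) (fun z => by simpa using hFint z (-1))
  -- `F` omits the integers, so `G` omits every point where `cos (π ·)` is an integer. Such points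
  -- meet every disc of radius `2`, whereas Bloch puts one of these discs in the range of a
  -- nonconstant `G`.
  have hconst : ∀ z, deriv G z = 0 := by
    intro z
    by_contra h
    obtain ⟨c, hc⟩ := exists_ball_subset_range_of_deriv_ne_zero hG h 2
    obtain ⟨v, hv, n, hn⟩ := exists_cos_pi_mul_eq_intCast c
    obtain ⟨x, rfl⟩ := hc hv
    exact hFint x n (by rw [hG' x, hn])
  have hGc := is_const_of_deriv_eq_zero hG hconst z w
  have h3 := hF' z
  rw [hG' z, hGc, ← hG' w, ← hF' w] at h3
  linear_combination h3 / 2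

/-- **Little Picard theorem**: an entire function omitting two values is constant. -/
theorem little_picard {f : ℂ → ℂ} (hf : Differentiable ℂ f)
    {a b : ℂ} (hab : a ≠ b) (ha : ∀ z, f z ≠ a) (hb : ∀ z, f z ≠ b) (z w : ℂ) : f z = f w := by
  have hba : b - a ≠ 0 := sub_ne_zero.2 hab.symm
  have := eq_const_of_differentiable_of_ne_zero_of_ne_one (f := fun z => (f z - a) / (b - a))
    (by fun_prop) (fun z => div_ne_zero (sub_ne_zero.2 (ha z)) hba)
    (fun z hz => hb z (by rw [div_eq_one_iff_eq hba] at hz; linear_combination hz)) z w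
  rw [div_left_inj' hba] at this
  linear_combination this

/-! ### Liouville, planar conformal harmonic maps, and weak hyperbolicity -/

open InnerProductSpace in
theorem isConst_coord_of_harmonicOnNhd_of_abs_le {n : ℕ} {f : ℂ → EuclideanSpace ℝ (Fin n)}
    (hf : HarmonicOnNhd f univ) (i : Fin n) {C : ℝ} (hC : ∀ z, |f z i| ≤ C) (z w : ℂ) :
    f z i = f w i := by
  refine bounded_harmonic_on_complex_plane_is_constant (fun z => f z i)
    (hf.comp_CLM (EuclideanSpace.proj i)) ?_ z w
  refine isBounded_iff_forall_norm_le.2 ⟨C, ?_⟩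
  rintro _ ⟨z, rfl⟩
  exact hC z

open Complex InnerProductSpace in
/-- A weakly conformal pair of real harmonic functions on the plane is the pair of real and
imaginary parts of an entire function or of the conjugate of an entire function. -/
theorem differentiable_or_differentiable_conj_of_conformal {u v : ℂ → ℝ}
    (hu : HarmonicOnNhd u univ) (hv : HarmonicOnNhd v univ)
    (h1 : ∀ z, fderiv ℝ u z 1 ^ 2 + fderiv ℝ v z 1 ^ 2 = fderiv ℝ u z I ^ 2 + fderiv ℝ v z I ^ 2)
    (h2 : ∀ z, fderiv ℝ u z 1 * fderiv ℝ u z I + fderiv ℝ v z 1 * fderiv ℝ v z I = 0) :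
    Differentiable ℂ (fun z => (u z : ℂ) + v z * I) ∨
      Differentiable ℂ (fun z => (u z : ℂ) - v z * I) := by
  set P : ℂ → ℂ := fun z => fderiv ℝ u z 1 - I * fderiv ℝ u z I with hP
  set Q : ℂ → ℂ := fun z => fderiv ℝ v z 1 - I * fderiv ℝ v z I with hQ
  have hPd : Differentiable ℂ P := fun z => HarmonicAt.differentiableAt_complex_partial (hu z (mem_univ z))
  have hQd : Differentiable ℂ Q := fun z => HarmonicAt.differentiableAt_complex_partial (hv z (mem_univ z))
  have hud : Differentiable ℝ u := fun z =>
    (hu z (mem_univ z)).1.differentiableAt two_ne_zero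
  have hvd : Differentiable ℝ v := fun z =>
    (hv z (mem_univ z)).1.differentiableAt two_ne_zero
  -- `P` and `Q` are twice the Wirtinger derivatives `∂u/∂z` and `∂v/∂z`, and conformality is
  -- exactly `P ^ 2 + Q ^ 2 = 0`. By the identity theorem one factor vanishes identically, and its
  -- vanishing is the Cauchy–Riemann system for `u - i v` or for `u + i v` respectively.
  have hmul : ∀ z, (P z + I * Q z) * (P z - I * Q z) = 0 := by
    intro z
    have e1 : ((fderiv ℝ u z 1 : ℂ) ^ 2 + (fderiv ℝ v z 1 : ℂ) ^ 2) =
      (fderiv ℝ u z I : ℂ) ^ 2 + (fderiv ℝ v z I : ℂ) ^ 2 := by exact_mod_cast h1 z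
    have e2 : (fderiv ℝ u z 1 : ℂ) * fderiv ℝ u z I + fderiv ℝ v z 1 * fderiv ℝ v z I = 0 := by
      exact_mod_cast h2 z
    simp only [hP, hQ]
    linear_combination e1 - 2 * I * e2 + ((fderiv ℝ u z I : ℂ) ^ 2 -
      (fderiv ℝ v z 1 - I * fderiv ℝ v z I) ^ 2 + (fderiv ℝ v z I : ℂ) ^ 2) * I_sq
  have hprod := AnalyticOnNhd.eq_zero_or_eq_zero_of_mul_eq_zero (U := (univ : Set ℂ))
    (f := fun z => P z + I * Q z) (g := fun z => P z - I * Q z)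
    (fun z _ => (hPd.add (hQd.const_mul I)).analyticAt z)
    (fun z _ => (hPd.sub (hQd.const_mul I)).analyticAt z)
    (fun z _ => hmul z) isPreconnected_univ
  have hfd : ∀ z, HasFDerivAt (fun z => (u z : ℂ)) (ofRealCLM ∘L fderiv ℝ u z) z := fun z =>
    ofRealCLM.hasFDerivAt.comp z (hud z).hasFDerivAt
  have hfd' : ∀ z, HasFDerivAt (fun z => (v z : ℂ) * I)
      (I • (ofRealCLM ∘L fderiv ℝ v z)) z := fun z =>
    (ofRealCLM.hasFDerivAt.comp z (hvd z).hasFDerivAt).mul_const I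
  rcases hprod with h | h
  · right
    intro z
    rw [differentiableAt_complex_iff_differentiableAt_real]
    have hd := (hfd z).sub (hfd' z)
    refine ⟨hd.differentiableAt, ?_⟩
    have hz := h z (mem_univ z)
    have hre := congrArg re hz
    have him := congrArg im hz
    simp [hP, hQ] at hre him
    erw [hd.fderiv]
    apply Complex.ext <;> simp <;> linarith
  · left
    intro z
    rw [differentiableAt_complex_iff_differentiableAt_real]
    have hd := (hfd z).add (hfd' z)
    refine ⟨hd.differentiableAt, ?_⟩
    have hz := h z (mem_univ z)
    have hre := congrArg re hz
    have him := congrArg im hz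
    simp [hP, hQ] at hre him
    erw [hd.fderiv]
    apply Complex.ext <;> simp <;> linarith

open Complex in
theorem little_picard_of_differentiable_or_conj {u v : ℂ → ℝ}
    (h : Differentiable ℂ (fun z => (u z : ℂ) + v z * I) ∨
      Differentiable ℂ (fun z => (u z : ℂ) - v z * I)) {a b : ℂ} (hab : a ≠ b)
    (ha : ∀ z, (⟨u z, v z⟩ : ℂ) ≠ a) (hb : ∀ z, (⟨u z, v z⟩ : ℂ) ≠ b) (z w : ℂ) :
    u z = u w ∧ v z = v w := by
  have e1 : ∀ z, (u z : ℂ) + v z * I = ⟨u z, v z⟩ := fun z => by apply Complex.ext <;> simp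
  have e2 : ∀ z, (u z : ℂ) - v z * I = (starRingEnd ℂ) ⟨u z, v z⟩ := fun z => by
    apply Complex.ext <;> simp
  rcases h with h | h
  · have := little_picard h hab (fun z => by rw [e1]; exact ha z)
      (fun z => by rw [e1]; exact hb z) z w
    simp only [e1, Complex.mk.injEq] at this
    exact this
  · have hinj := (starRingEnd ℂ).injective
    have := little_picard h (hinj.ne hab) (fun z => by rw [e2]; exact hinj.ne (ha z))
      (fun z => by rw [e2]; exact hinj.ne (hb z)) z w
    simp only [e2] at this
    simpa using hinj this

namespace MinimalSurfaces

theorem abs_coord_le_of_mem_Omega {D : TopologicalSpace.Opens ℂ}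
    {p : EuclideanSpace ℝ (Fin 3)} (hp : p ∈ Omega D) (h : p 2 ≠ 0) {i : Fin 3} (hi : i ≠ 2) :
    |p i| ≤ 1 / |p 2| := by
  have h2 : 0 < |p 2| := abs_pos.2 h
  rw [le_div_iff₀ h2, ← abs_mul, ← sq_le_one_iff_abs_le_one]
  have := hp.2.1
  have h0 : 0 ≤ p 2 ^ 2 * p 0 ^ 2 := by positivity
  have h1 : 0 ≤ p 2 ^ 2 * p 1 ^ 2 := by positivity
  fin_cases i
  · simp only [Fin.zero_eta]; nlinarith
  · simp only [Fin.mk_one]; nlinarith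
  · exact absurd rfl hi

/-- The bounded height is constant by Liouville. The case of height zero then rests on Picard, and
the case of nonzero height on Liouville again. -/
theorem isWeaklyHyperbolic_Omega {D : TopologicalSpace.Opens ℂ} {a b : ℂ} (hab : a ≠ b)
    (ha : a ∉ D) (hb : b ∉ D) : IsWeaklyHyperbolic (Omega D) := by
  intro f hf hfΩ
  have h2 := isConst_coord_of_harmonicOnNhd_of_abs_le hf.1 2 (C := 1) (fun z => (hfΩ z).1.le)
  suffices h : ∀ z, f z 0 = f 0 0 ∧ f z 1 = f 0 1 by
    refine ⟨f 0, fun z => ?_⟩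
    ext i
    fin_cases i
    · exact (h z).1
    · exact (h z).2
    · exact h2 z 0
  by_cases hc : f 0 2 = 0
  · have hproj : ∀ (i : Fin 3) z, HasFDerivAt (fun z => f z i)
        (EuclideanSpace.proj i ∘L fderiv ℝ f z) z := fun i z =>
      (EuclideanSpace.proj (𝕜 := ℝ) i).hasFDerivAt.comp z
        ((hf.1 z (mem_univ z)).1.differentiableAt two_ne_zero).hasFDerivAt
    have hfd : ∀ (i : Fin 3) z w, fderiv ℝ (fun z => f z i) z w = fderiv ℝ f z w i := by
      intro i z w
      rw [(hproj i z).fderiv]; rfl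
    have hfd2 : ∀ z w, fderiv ℝ f z w 2 = 0 := by
      intro z w
      have : (fun z => f z 2) = fun _ => f 0 2 := funext fun z => h2 z 0
      rw [← hfd, this]; simp
    have hconf := hf.2
    have hor := differentiable_or_differentiable_conj_of_conformal
      (u := fun z => f z 0) (v := fun z => f z 1)
      (hf.1.comp_CLM (EuclideanSpace.proj 0)) (hf.1.comp_CLM (EuclideanSpace.proj 1))
      (fun z => by
        have := (hconf z (mem_univ z)).1
        have h3 : ‖pderiv 0 f z‖ ^ 2 = ‖pderiv 1 f z‖ ^ 2 := by rw [this]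
        simp only [EuclideanSpace.norm_sq_eq, Fin.sum_univ_three, pderiv, planeBasis,
          Matrix.cons_val_zero, Matrix.cons_val_one, hfd2, Real.norm_eq_abs, sq_abs] at h3
        simp only [hfd]
        linarith)
      (fun z => by
        have h3 := (hconf z (mem_univ z)).2
        simp only [PiLp.inner_apply, Fin.sum_univ_three, pderiv, planeBasis,
          Matrix.cons_val_zero, Matrix.cons_val_one, hfd2] at h3
        simp at h3
        simp only [hfd]
        linarith)
    have hD : ∀ z, (⟨f z 0, f z 1⟩ : ℂ) ∈ D := fun z => (hfΩ z).2.2 (by rw [h2 z 0, hc])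
    exact fun z => little_picard_of_differentiable_or_conj hor hab
      (fun z h => ha (h ▸ hD z)) (fun z h => hb (h ▸ hD z)) z 0
  · have hb : ∀ (i : Fin 3), i ≠ 2 → ∀ z, |f z i| ≤ 1 / |f 0 2| := by
      intro i hi z
      have := abs_coord_le_of_mem_Omega (hfΩ z) (by rwa [h2 z 0]) hi
      rwa [h2 z 0] at this
    exact fun z => ⟨isConst_coord_of_harmonicOnNhd_of_abs_le hf.1 0 (hb 0 (by decide)) z 0,
      isConst_coord_of_harmonicOnNhd_of_abs_le hf.1 1 (hb 1 (by decide)) z 0⟩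

end MinimalSurfaces

namespace MinimalSurfaces

/-! ### `Omega D` is a domain -/

theorem isOpen_Omega (D : TopologicalSpace.Opens ℂ) : IsOpen (Omega D) := by
  have e : Omega D = {p : EuclideanSpace ℝ (Fin 3) | |p 2| < 1} ∩
      ({p | p 2 ^ 2 * (p 0 ^ 2 + p 1 ^ 2) < 1} ∩
        ({p | p 2 ≠ 0} ∪ (fun p => (p 0 : ℂ) + p 1 * Complex.I) ⁻¹' (D : Set ℂ))) := by
    ext p
    have : ((⟨p 0, p 1⟩ : ℂ)) = (p 0 : ℂ) + p 1 * Complex.I := by apply Complex.ext <;> simp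
    simp only [Omega, this, mem_ofPred_eq, mem_inter_iff, mem_union, mem_preimage,
      SetLike.mem_coe]
    tauto
  rw [e]
  refine (isOpen_lt (by fun_prop) continuous_const).inter
    ((isOpen_lt (by fun_prop) continuous_const).inter
      ((isOpen_ne_fun (by fun_prop) continuous_const).union (D.isOpen.preimage (by fun_prop))))

/-- The part of `Omega D` above (`σ = 1`) or below (`σ = -1`) the plane `z = 0`. -/
def OmegaSide (σ : ℝ) : Set (EuclideanSpace ℝ (Fin 3)) :=
  {p | 0 < σ * p 2 ∧ |p 2| < 1 ∧ p 2 ^ 2 * (p 0 ^ 2 + p 1 ^ 2) < 1}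

/-- The substitution `w = z (x + i y)` straightens each side to a product of an interval and a disc,
which is convex. -/
theorem isPreconnected_OmegaSide (σ : ℝ) : IsPreconnected (OmegaSide σ) := by
  have hconv : Convex ℝ {p : ℝ × ℂ | 0 < σ * p.1 ∧ |p.1| < 1 ∧ ‖p.2‖ < 1} := by
    have e : {p : ℝ × ℂ | 0 < σ * p.1 ∧ |p.1| < 1 ∧ ‖p.2‖ < 1} =
        (((fun x : ℝ => σ • x) ⁻¹' Ioi 0) ∩ Metric.ball 0 1) ×ˢ Metric.ball 0 1 := by
      ext p
      simp [mem_prod, and_assoc]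
    rw [e]
    exact (((convex_Ioi 0).is_linear_preimage (IsLinearMap.isLinearMap_smul σ)).inter
      (convex_ball 0 1)).prod (convex_ball 0 1)
  have himg : OmegaSide σ = (fun p : ℝ × ℂ => !₂[p.2.re / p.1, p.2.im / p.1, p.1]) ''
      {p : ℝ × ℂ | 0 < σ * p.1 ∧ |p.1| < 1 ∧ ‖p.2‖ < 1} := by
    have hn : ∀ w : ℂ, ‖w‖ < 1 ↔ w.re ^ 2 + w.im ^ 2 < 1 := by
      intro w
      rw [← sq_lt_one_iff₀ (norm_nonneg _), Complex.sq_norm, Complex.normSq_apply]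
      ring_nf
    ext p
    constructor
    · rintro ⟨h1, h2, h3⟩
      have h0 : p 2 ≠ 0 := by rintro h; simp [h] at h1
      refine ⟨(p 2, ⟨p 2 * p 0, p 2 * p 1⟩), ⟨h1, h2, ?_⟩, ?_⟩
      · rw [hn]; simp only; linarith
      · ext i
        fin_cases i
        · simp [h0]
        · simp [h0]
        · simp
    · rintro ⟨⟨z, w⟩, ⟨h1, h2, h3⟩, rfl⟩
      have h0 : z ≠ 0 := by rintro h; simp [h] at h1
      refine ⟨by simpa using h1, by simpa using h2, ?_⟩
      rw [hn] at h3
      have : z ^ 2 * ((w.re / z) ^ 2 + (w.im / z) ^ 2) = w.re ^ 2 + w.im ^ 2 := by field_simp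
      simpa [this] using h3
  rw [himg]
  refine hconv.isPreconnected.image _ ?_
  have h0 : ∀ p ∈ {p : ℝ × ℂ | 0 < σ * p.1 ∧ |p.1| < 1 ∧ ‖p.2‖ < 1}, p.1 ≠ 0 := by
    rintro p ⟨h1, -⟩ h
    simp [h] at h1
  refine (PiLp.continuous_toLp 2 _).comp_continuousOn (continuousOn_pi.2 fun i => ?_)
  fin_cases i
  · exact (Complex.continuous_re.comp continuous_snd).continuousOn.div continuousOn_fst h0
  · exact (Complex.continuous_im.comp continuous_snd).continuousOn.div continuousOn_fst h0
  · exact continuousOn_fst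

theorem mem_closure_OmegaSide {σ : ℝ} (hσ : σ ≠ 0) {p : EuclideanSpace ℝ (Fin 3)}
    (hp : p 2 = 0) : p ∈ closure (OmegaSide σ) := by
  have hlim : Filter.Tendsto
      (fun t : ℝ => p + (t * σ) • EuclideanSpace.single (2 : Fin 3) (1 : ℝ)) (𝓝[>] 0) (𝓝 p) := by
    refine tendsto_nhdsWithin_of_tendsto_nhds ?_
    have : Continuous fun t : ℝ => p + (t * σ) • EuclideanSpace.single (2 : Fin 3) (1 : ℝ) := by
      fun_prop
    simpa using this.tendsto 0
  refine mem_closure_of_tendsto hlim ?_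
  have h1 : ∀ᶠ t : ℝ in 𝓝[>] 0, |t * σ| < 1 := by
    refine Filter.Eventually.filter_mono nhdsWithin_le_nhds ?_
    have : Continuous fun t : ℝ => |t * σ| := by fun_prop
    exact this.continuousAt.eventually_lt continuousAt_const (by simp)
  have h2 : ∀ᶠ t : ℝ in 𝓝[>] 0, (t * σ) ^ 2 * (p 0 ^ 2 + p 1 ^ 2) < 1 := by
    refine Filter.Eventually.filter_mono nhdsWithin_le_nhds ?_
    have : Continuous fun t : ℝ => (t * σ) ^ 2 * (p 0 ^ 2 + p 1 ^ 2) := by fun_prop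
    exact this.continuousAt.eventually_lt continuousAt_const (by simp)
  filter_upwards [h1, h2, self_mem_nhdsWithin] with t ht1 ht2 ht
  have ht : 0 < t := ht
  refine ⟨?_, ?_, ?_⟩
  · have : 0 < t * (σ * σ) := mul_pos ht (mul_self_pos.2 hσ)
    simp [hp]
    linarith
  · simpa [hp] using ht1
  · simpa [hp] using ht2

/-- Each side stays preconnected when the slice `z = 0` is adjoined, since that slice lies in its
closure. The two enlarged sides share a point of the slice. -/
theorem isConnected_Omega {D : TopologicalSpace.Opens ℂ} (hD : (D : Set ℂ).Nonempty) :
    IsConnected (Omega D) := by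
  obtain ⟨w, hw⟩ := hD
  set Z : Set (EuclideanSpace ℝ (Fin 3)) := {p | p 2 = 0 ∧ (⟨p 0, p 1⟩ : ℂ) ∈ D} with hZ
  have hside : ∀ σ : ℝ, σ ≠ 0 → IsPreconnected (OmegaSide σ ∪ Z) := fun σ hσ =>
    (isPreconnected_OmegaSide σ).subset_closure subset_union_left
      (union_subset subset_closure fun p hp => mem_closure_OmegaSide hσ hp.1)
  have hZw : !₂[w.re, w.im, 0] ∈ Z := by simpa [hZ] using hw
  have e : Omega D = (OmegaSide 1 ∪ Z) ∪ (OmegaSide (-1) ∪ Z) := by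
    ext p
    constructor
    · rintro ⟨h1, h2, h3⟩
      rcases lt_trichotomy (p 2) 0 with h | h | h
      · exact Or.inr (Or.inl ⟨by linarith, h1, h2⟩)
      · exact Or.inl (Or.inr ⟨h, h3 h⟩)
      · exact Or.inl (Or.inl ⟨by linarith, h1, h2⟩)
    · have hs : ∀ σ : ℝ, p ∈ OmegaSide σ → p ∈ Omega D := by
        rintro σ ⟨h1, h2, h3⟩
        exact ⟨h2, h3, fun h => by simp [h] at h1⟩
      have hz : p ∈ Z → p ∈ Omega D := by
        rintro ⟨h1, h2⟩
        exact ⟨by simp [h1], by simp [h1], fun _ => h2⟩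
      rintro ((h | h) | (h | h))
      exacts [hs _ h, hz h, hs _ h, hz h]
  rw [e]
  exact ⟨⟨_, Or.inl (Or.inr hZw)⟩,
    (hside 1 one_ne_zero).union _ (Or.inr hZw) (Or.inr hZw) (hside (-1) (by norm_num))⟩

/-! ### `Omega D` is not hyperbolic -/

open InnerProductSpace in
/-- The upper bound for the minimal pseudometric given by a flat disc. -/
theorem minimalPseudometric_le_of_flat_disc {n : ℕ} {Ω : Set (EuclideanSpace ℝ (Fin n))}
    {p e e' : EuclideanSpace ℝ (Fin n)} (he : ‖e‖ = 1) (he' : ‖e'‖ = 1) (hee' : ⟪e, e'⟫ = 0)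
    {ρ c : ℝ} (hρ : 0 < ρ) (hc : c ≠ 0)
    (hΩ : ∀ a b : ℝ, a ^ 2 + b ^ 2 < ρ ^ 2 → p + (a • e + b • e') ∈ Ω) :
    minimalPseudometric Ω p (c • e) ≤ ENNReal.ofReal (|c| / ρ) := by
  have hc' : 0 < |c| := abs_pos.2 hc
  -- The sign of `c` must be built into the disc, because `r = ρ / |c|` has to be positive.
  set s : ℝ := c / |c| with hs
  have hs2 : s ^ 2 = 1 := by rw [hs, div_pow, sq_abs, div_self (pow_ne_zero 2 hc)]
  have hs1 : |s| = 1 := by rw [hs, abs_div, abs_abs, div_self hc'.ne']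
  set L : ℂ →L[ℝ] EuclideanSpace ℝ (Fin n) :=
    Complex.reCLM.smulRight ((ρ * s) • e) + Complex.imCLM.smulRight (ρ • e') with hL
  set f : ℂ → EuclideanSpace ℝ (Fin n) := fun w => p + L w with hf
  have hfd : ∀ z, fderiv ℝ f z = L := fun z => by
    rw [hf, fderiv_const_add, L.fderiv]
  have hp0 : ∀ z, pderiv 0 f z = (ρ * s) • e := fun z => by
    simp [pderiv, planeBasis, hfd, hL]
  have hp1 : ∀ z, pderiv 1 f z = ρ • e' := fun z => by
    simp [pderiv, planeBasis, hfd, hL]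
  have hr : 1 / (ρ / |c|) = |c| / ρ := by rw [one_div_div]
  rw [← hr]
  refine iInf_le_of_le (ρ / |c|) (iInf_le_of_le f (iInf_le_of_le ?_ le_rfl))
  refine ⟨by positivity, ⟨?_, fun z _ => ?_⟩, fun w hw => ?_, ?_, ?_⟩
  · refine (harmonicOnNhd_const p).add ?_
    intro z _
    exact HarmonicAt.comp_CLM (f := fun w : ℂ => w) (analyticAt_id (𝕜 := ℂ)).harmonicAt L
  · rw [hp0, hp1, norm_smul, norm_smul, he, he', Real.norm_eq_abs, Real.norm_eq_abs, abs_mul, hs1,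
      real_inner_smul_left, real_inner_smul_right, hee']
    simp
  · have h1 : ‖w‖ ^ 2 < 1 := by
      rw [sq_lt_one_iff₀ (norm_nonneg _)]; simpa using hw
    rw [Complex.sq_norm, Complex.normSq_apply] at h1
    have := hΩ (w.re * (ρ * s)) (w.im * ρ) (by
      have : (w.re * (ρ * s)) ^ 2 + (w.im * ρ) ^ 2 = (w.re * w.re + w.im * w.im) * ρ ^ 2 := by
        linear_combination (w.re * ρ) ^ 2 * hs2
      rw [this]
      have : 0 < ρ ^ 2 := by positivity
      nlinarith)
    simpa [hf, hL, smul_smul] using this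
  · simp [hf]
  · rw [hp0, smul_smul, hs]
    congr 1
    ring

/-- Bound on the minimal pseudodistance by a constant path speed. -/
theorem minimalDist_le_of_ae_le {n : ℕ} {Ω : Set (EuclideanSpace ℝ (Fin n))}
    {p q : EuclideanSpace ℝ (Fin n)} {γ : ℝ → EuclideanSpace ℝ (Fin n)} (hγ : IsPiecewiseC1 γ)
    (hΩ : MapsTo γ (Icc 0 1) Ω) (h0 : γ 0 = p) (h1 : γ 1 = q) {C : ℝ≥0∞}
    (hC : ∀ᵐ t, t ∈ Icc (0 : ℝ) 1 → minimalPseudometric Ω (γ t) (deriv γ t) ≤ C) :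
    minimalDist Ω p q ≤ C := by
  refine iInf_le_of_le γ (iInf_le_of_le ⟨hγ, hΩ, h0, h1⟩ ?_)
  refine (setLIntegral_mono_ae' measurableSet_Icc hC).trans ?_
  simp

/-- The path of three segments: from `p` by `ε • e₂`, then by `η • e₀`, then by `-ε • e₂`. -/
noncomputable def bridge {E : Type*} [AddCommGroup E] [Module ℝ E] (p e₀ e₂ : E) (η ε t : ℝ) : E :=
  if t ≤ 1 / 3 then p + (3 * t * ε) • e₂
  else if t ≤ 2 / 3 then p + ((3 * t - 1) * η) • e₀ + ε • e₂
  else p + η • e₀ + ((3 - 3 * t) * ε) • e₂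

section Bridge

variable {E : Type*} [NormedAddCommGroup E] [NormedSpace ℝ E] {p e₀ e₂ : E} {η ε t : ℝ}

theorem bridge_of_le (h : t ≤ 1 / 3) : bridge p e₀ e₂ η ε t = p + (3 * t * ε) • e₂ := by
  rw [bridge, if_pos h]

theorem bridge_of_mem_Icc (h1 : 1 / 3 ≤ t) (h2 : t ≤ 2 / 3) :
    bridge p e₀ e₂ η ε t = p + ((3 * t - 1) * η) • e₀ + ε • e₂ := by
  rcases h1.eq_or_lt with rfl | h1
  · rw [bridge, if_pos le_rfl]; norm_num
  · rw [bridge, if_neg h1.not_ge, if_pos h2]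

theorem bridge_of_ge (h1 : 2 / 3 ≤ t) :
    bridge p e₀ e₂ η ε t = p + η • e₀ + ((3 - 3 * t) * ε) • e₂ := by
  rcases h1.eq_or_lt with rfl | h1
  · rw [bridge_of_mem_Icc (by norm_num) le_rfl]; norm_num
  · rw [bridge, if_neg (by linarith), if_neg h1.not_ge]

theorem isPiecewiseC1_bridge : IsPiecewiseC1 (bridge p e₀ e₂ η ε) := by
  refine ⟨3, fun i => (i : ℝ) / 3, fun i j h => by simp only; gcongr, by simp, by norm_num, ?_⟩
  intro i hi
  interval_cases i
  · refine ContDiffOn.congr (f := fun t => p + (3 * t * ε) • e₂) ?_ fun t ht =>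
      bridge_of_le (by simpa using ht.2)
    exact ContDiff.contDiffOn (by fun_prop)
  · refine ContDiffOn.congr (f := fun t => p + ((3 * t - 1) * η) • e₀ + ε • e₂) ?_ fun t ht =>
      bridge_of_mem_Icc (by simpa using ht.1) (by have := ht.2; norm_num at this; linarith)
    exact ContDiff.contDiffOn (by fun_prop)
  · refine ContDiffOn.congr (f := fun t => p + η • e₀ + ((3 - 3 * t) * ε) • e₂) ?_ fun t ht =>
      bridge_of_ge (by have := ht.1; norm_num at this; linarith)
    exact ContDiff.contDiffOn (by fun_prop)

theorem deriv_bridge_of_lt (h : t < 1 / 3) : deriv (bridge p e₀ e₂ η ε) t = (3 * ε) • e₂ := by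
  have : bridge p e₀ e₂ η ε =ᶠ[𝓝 t] fun t => p + (3 * t * ε) • e₂ := by
    filter_upwards [Iio_mem_nhds h] with s hs using bridge_of_le (le_of_lt hs)
  rw [this.deriv_eq]
  have h1 : HasDerivAt (fun t : ℝ => 3 * t * ε) (3 * ε) t := by
    simpa using ((hasDerivAt_id t).const_mul 3).mul_const ε
  exact ((h1.smul_const e₂).const_add p).deriv

theorem deriv_bridge_of_mem_Ioo (h1 : 1 / 3 < t) (h2 : t < 2 / 3) :
    deriv (bridge p e₀ e₂ η ε) t = (3 * η) • e₀ := by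
  have : bridge p e₀ e₂ η ε =ᶠ[𝓝 t] fun t => p + ((3 * t - 1) * η) • e₀ + ε • e₂ := by
    filter_upwards [Ioo_mem_nhds h1 h2] with s hs using bridge_of_mem_Icc hs.1.le hs.2.le
  rw [this.deriv_eq]
  have h1 : HasDerivAt (fun t : ℝ => (3 * t - 1) * η) (3 * η) t := by
    simpa using (((hasDerivAt_id t).const_mul 3).sub_const 1).mul_const η
  exact (((h1.smul_const e₀).const_add p).add_const _).deriv

theorem deriv_bridge_of_gt (h : 2 / 3 < t) : deriv (bridge p e₀ e₂ η ε) t = (-3 * ε) • e₂ := by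
  have : bridge p e₀ e₂ η ε =ᶠ[𝓝 t] fun t => p + η • e₀ + ((3 - 3 * t) * ε) • e₂ := by
    filter_upwards [Ioi_mem_nhds h] with s hs using bridge_of_ge (le_of_lt hs)
  rw [this.deriv_eq]
  have h1 : HasDerivAt (fun t : ℝ => (3 - 3 * t) * ε) (-3 * ε) t := by
    simpa using (((hasDerivAt_id t).const_mul 3).const_sub 3).mul_const ε
  exact ((h1.smul_const e₂).const_add _).deriv

end Bridge

theorem norm_smul_add_smul_of_orthonormal {E : Type*} [NormedAddCommGroup E]
    [InnerProductSpace ℝ E] {e e' : E} (he : ‖e‖ = 1) (he' : ‖e'‖ = 1) (hee' : ⟪e, e'⟫ = 0)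
    (a b : ℝ) : ‖a • e + b • e'‖ ^ 2 = a ^ 2 + b ^ 2 := by
  rw [norm_add_sq_real, norm_smul, norm_smul, he, he', real_inner_smul_left,
    real_inner_smul_right, hee']
  simp

/-- At height `ε`, horizontal discs of radius `1 / (2 ε)` lie in `Omega D`. -/
theorem mem_Omega_of_high {D : TopologicalSpace.Opens ℂ} {p q : EuclideanSpace ℝ (Fin 3)}
    {ε x a b : ℝ} (hε : 0 < ε) (hε1 : ε < 1) (hεM : ε * (|p 0| + 1 + |p 1|) ≤ 1 / 2)
    (hx : 0 ≤ x) (hx' : x ≤ 1) (hab : a ^ 2 + b ^ 2 < (1 / (2 * ε)) ^ 2)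
    (c0 : q 0 = (p 0 + x) + a) (c1 : q 1 = p 1 + b) (c2 : q 2 = ε) : q ∈ Omega D := by
  refine ⟨?_, ?_, fun h => absurd (c2 ▸ h) hε.ne'⟩
  · rw [c2, abs_of_pos hε]; exact hε1
  · rw [c0, c1, c2]
    set M := |p 0| + 1 + |p 1| with hM
    have hM1 : (p 0 + x) ^ 2 + p 1 ^ 2 ≤ M ^ 2 := by
      have h1 : |p 0 + x| ≤ |p 0| + 1 := (abs_add_le _ _).trans (by
        rw [abs_of_nonneg hx]; linarith)
      have h2 : (p 0 + x) ^ 2 ≤ (|p 0| + 1) ^ 2 := by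
        rw [← sq_abs (p 0 + x)]; gcongr
      have h3 := abs_nonneg (p 0)
      have h4 := abs_nonneg (p 1)
      have h5 := sq_abs (p 1)
      nlinarith
    have hM2 : ε ^ 2 * M ^ 2 ≤ 1 / 4 := by
      have : 0 ≤ ε * M := by positivity
      nlinarith
    have h3 : ε ^ 2 * (a ^ 2 + b ^ 2) < 1 / 4 := by
      have : ε ^ 2 * (1 / (2 * ε)) ^ 2 = 1 / 4 := by field_simp; norm_num
      rw [← this]; gcongr
    have h4 : ε ^ 2 * ((p 0 + x) ^ 2 + p 1 ^ 2) ≤ 1 / 4 :=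
      (mul_le_mul_of_nonneg_left hM1 (by positivity)).trans hM2
    -- Centre and displacement each contribute at most `1 / 4` after scaling by `ε ^ 2`, the latter
    -- strictly, so the factor `2` still leaves a total below `1`.
    have h5 : (p 0 + x + a) ^ 2 + (p 1 + b) ^ 2 ≤
        2 * ((p 0 + x) ^ 2 + p 1 ^ 2) + 2 * (a ^ 2 + b ^ 2) := by
      nlinarith [sq_nonneg (p 0 + x - a), sq_nonneg (p 1 - b)]
    have h6 := mul_le_mul_of_nonneg_left h5 (sq_nonneg ε)
    nlinarith

/-- If flat discs of radius `η` containing the direction `e₂` and flat discs of radius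
`1 / (2 ε)` containing the direction `e₀` lie in `Ω` along the three segments of a bridge of
height `ε`, then the end points of the bridge are close in the minimal pseudodistance. -/
theorem minimalDist_le_of_bridge {n : ℕ} {Ω : Set (EuclideanSpace ℝ (Fin n))}
    {p e₀ e₁ e₂ : EuclideanSpace ℝ (Fin n)} (n₀ : ‖e₀‖ = 1) (n₁ : ‖e₁‖ = 1) (n₂ : ‖e₂‖ = 1)
    (o₀₁ : ⟪e₀, e₁⟫ = 0) (o₂₀ : ⟪e₂, e₀⟫ = 0) {η ε : ℝ} (hη : 0 < η) (hη1 : η ≤ 1)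
    (hε : 0 < ε) (hεη : ε < η)
    (near : ∀ x a b : ℝ, 0 ≤ x → x ≤ η → a ^ 2 + b ^ 2 < (3 * η) ^ 2 →
      p + x • e₀ + (a • e₂ + b • e₀) ∈ Ω)
    (high : ∀ x a b : ℝ, 0 ≤ x → x ≤ η → a ^ 2 + b ^ 2 < (1 / (2 * ε)) ^ 2 →
      p + x • e₀ + ε • e₂ + (a • e₀ + b • e₁) ∈ Ω) :
    minimalDist Ω p (p + η • e₀) ≤ ENNReal.ofReal ((3 / η + 6) * ε) := by
  -- Vertical speed `3 ε` in discs of radius `η` costs `3 ε / η`. Horizontal speed `3 η` in discs of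
  -- radius `1 / (2 ε)` costs `6 η ε ≤ 6 ε`. The sum `(3 / η + 6) ε` bounds both.
  have vert : ∀ x z c : ℝ, 0 ≤ x → x ≤ η → 0 ≤ z → z ≤ ε → c ≠ 0 → |c| ≤ 3 * ε →
      minimalPseudometric Ω (p + x • e₀ + z • e₂) (c • e₂) ≤
        ENNReal.ofReal ((3 / η + 6) * ε) := by
    intro x z c hx hx' hz hz' hc hc'
    refine (minimalPseudometric_le_of_flat_disc n₂ n₀ o₂₀ hη hc fun a b hab => ?_).trans
      (ENNReal.ofReal_le_ofReal ?_)
    · have hzη : z ^ 2 ≤ η ^ 2 := by gcongr; linarith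
      have := near x (z + a) b hx hx' (by nlinarith [sq_nonneg (z - a), sq_nonneg b])
      rw [add_smul] at this
      convert this using 1
      abel
    · have : |c| / η ≤ 3 * ε / η := by gcongr
      have : (3 / η + 6) * ε = 3 * ε / η + 6 * ε := by ring
      linarith
  have small : ∀ z : ℝ, 0 ≤ z → z ≤ ε → z ^ 2 + 0 ^ 2 < (3 * η) ^ 2 := by
    intro z hz hz'
    nlinarith
  refine minimalDist_le_of_ae_le (γ := bridge p e₀ e₂ η ε) isPiecewiseC1_bridge ?_ ?_ ?_ ?_
  · rintro t ⟨ht0, ht1⟩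
    rcases le_total t (1 / 3) with h | h
    · rw [bridge_of_le h]
      have := near 0 (3 * t * ε) 0 le_rfl hη.le (small _ (by positivity) (by nlinarith))
      simpa using this
    rcases le_total t (2 / 3) with h' | h'
    · rw [bridge_of_mem_Icc h h']
      have := high ((3 * t - 1) * η) 0 0 (mul_nonneg (by linarith) hη.le) (by nlinarith)
        (by rw [zero_pow two_ne_zero, add_zero]; positivity)
      simpa using this
    · rw [bridge_of_ge h']
      have := near η ((3 - 3 * t) * ε) 0 hη.le le_rfl
        (small _ (mul_nonneg (by linarith) hε.le) (by nlinarith))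
      simpa using this
  · rw [bridge_of_le (by norm_num)]; simp
  · rw [bridge_of_ge (by norm_num)]; simp
  -- Only the two corners are exceptional: the outer formulas for `bridge` extend beyond `[0, 1]`,
  -- so `deriv` is also the expected one at `0` and `1`.
  · have hfin : ∀ᵐ t : ℝ, t ∉ ({1 / 3, 2 / 3} : Set ℝ) :=
      (Set.toFinite _).countable.ae_notMem volume
    filter_upwards [hfin] with t ht htI
    simp only [mem_insert_iff, mem_singleton_iff, not_or] at ht
    rcases lt_or_gt_of_ne ht.1 with h | h
    · rw [deriv_bridge_of_lt h, bridge_of_le h.le]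
      have := vert 0 (3 * t * ε) (3 * ε) le_rfl hη.le
        (by have := htI.1; positivity) (by nlinarith) (by positivity)
        (by rw [abs_of_pos (by positivity)])
      simpa using this
    rcases lt_or_gt_of_ne ht.2 with h' | h'
    · rw [deriv_bridge_of_mem_Ioo h h', bridge_of_mem_Icc h.le h'.le]
      refine (minimalPseudometric_le_of_flat_disc (ρ := 1 / (2 * ε)) n₀ n₁ o₀₁ (by positivity)
        (by positivity) fun a b hab => high _ a b (mul_nonneg (by linarith) hη.le)
          (by nlinarith) hab).trans (ENNReal.ofReal_le_ofReal ?_)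
      rw [abs_of_pos (by positivity)]
      have h1 : 3 * η / (1 / (2 * ε)) = 6 * η * ε := by field_simp; norm_num
      have h2 : 0 < 3 / η := by positivity
      rw [h1]
      gcongr
      linarith
    · rw [deriv_bridge_of_gt h', bridge_of_ge h'.le]
      exact vert η ((3 - 3 * t) * ε) (-3 * ε) hη.le le_rfl
        (mul_nonneg (by linarith [htI.2]) hε.le) (by nlinarith)
        (mul_ne_zero (by norm_num) hε.ne') (by rw [abs_mul, abs_of_pos hε]; norm_num)

theorem minimalDist_Omega_le {D : TopologicalSpace.Opens ℂ} {p : EuclideanSpace ℝ (Fin 3)}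
    (hp : p 2 = 0) {η : ℝ} (hη : 0 < η) (hη1 : η ≤ 1)
    (hball : Metric.ball p (4 * η) ⊆ Omega D) {ε : ℝ} (hε : 0 < ε) (hεη : ε < η)
    (hεM : ε * (|p 0| + 1 + |p 1|) ≤ 1 / 2) :
    minimalDist (Omega D) p (p + η • EuclideanSpace.single 0 1) ≤
      ENNReal.ofReal ((3 / η + 6) * ε) := by
  have n₀ : ‖(EuclideanSpace.single 0 1 : EuclideanSpace ℝ (Fin 3))‖ = 1 := by simp
  have n₂ : ‖(EuclideanSpace.single 2 1 : EuclideanSpace ℝ (Fin 3))‖ = 1 := by simp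
  have o₂₀ : ⟪(EuclideanSpace.single 2 1 : EuclideanSpace ℝ (Fin 3)),
      EuclideanSpace.single 0 1⟫ = 0 := by simp [EuclideanSpace.inner_single_left]
  refine minimalDist_le_of_bridge (e₁ := EuclideanSpace.single 1 1)
    (e₂ := EuclideanSpace.single 2 1) n₀ (by simp) n₂
    (by simp [EuclideanSpace.inner_single_left]) o₂₀ hη hη1 hε hεη ?_ ?_
  · intro x a b hx hx' hab
    apply hball
    rw [← norm_smul_add_smul_of_orthonormal n₂ n₀ o₂₀] at hab
    have h2 := lt_of_pow_lt_pow_left₀ 2 (by positivity) hab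
    have h3 : ‖x • (EuclideanSpace.single 0 1 : EuclideanSpace ℝ (Fin 3))‖ ≤ η := by
      rw [norm_smul, n₀, Real.norm_eq_abs, abs_of_nonneg hx]; linarith
    rw [Metric.mem_ball, dist_eq_norm, add_assoc, add_sub_cancel_left]
    refine (norm_add_le _ _).trans_lt ?_
    linarith
  · intro x a b hx hx' hab
    exact mem_Omega_of_high hε (by linarith) hεM hx (by linarith) hab (by simp) (by simp)
      (by simp [hp])

/-- With the horizontal displacement `η` fixed, the bridge height `ε` tends to zero and the cost
goes with it. -/
theorem not_isHyperbolic_Omega {D : TopologicalSpace.Opens ℂ} (hD : (D : Set ℂ).Nonempty) :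
    ¬ IsHyperbolic (Omega D) := by
  obtain ⟨w, hw⟩ := hD
  set p : EuclideanSpace ℝ (Fin 3) := !₂[w.re, w.im, 0] with hp
  have hp2 : p 2 = 0 := by simp [hp]
  have hpΩ : p ∈ Omega D := ⟨by simp [hp], by simp [hp], fun _ => by simpa [hp] using hw⟩
  obtain ⟨δ, hδ, hball⟩ := Metric.isOpen_iff.1 (isOpen_Omega D) p hpΩ
  set η := min (δ / 4) 1 with hη
  have hη0 : 0 < η := by positivity
  have hball' : Metric.ball p (4 * η) ⊆ Omega D :=
    (Metric.ball_subset_ball (by linarith [min_le_left (δ / 4) 1])).trans hball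
  intro hyp
  have hq : p + η • EuclideanSpace.single 0 1 ∈ Omega D := by
    apply hball'
    simp [norm_smul, abs_of_pos hη0]
    linarith
  have hlim : Filter.Tendsto (fun ε : ℝ => ENNReal.ofReal ((3 / η + 6) * ε)) (𝓝[>] 0) (𝓝 0) := by
    refine tendsto_nhdsWithin_of_tendsto_nhds ?_
    have : Continuous fun ε : ℝ => ENNReal.ofReal ((3 / η + 6) * ε) :=
      ENNReal.continuous_ofReal.comp (by fun_prop)
    simpa using this.tendsto 0
  have hzero : minimalDist (Omega D) p (p + η • EuclideanSpace.single 0 1) = 0 := by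
    refine le_antisymm (ge_of_tendsto hlim ?_) zero_le
    have h1 : ∀ᶠ ε : ℝ in 𝓝[>] 0, ε < η :=
      Filter.Eventually.filter_mono nhdsWithin_le_nhds (eventually_lt_nhds hη0)
    have h2 : ∀ᶠ ε : ℝ in 𝓝[>] 0, ε * (|p 0| + 1 + |p 1|) < 1 / 2 := by
      refine Filter.Eventually.filter_mono nhdsWithin_le_nhds ?_
      have : Continuous fun ε : ℝ => ε * (|p 0| + 1 + |p 1|) := by fun_prop
      exact this.continuousAt.eventually_lt continuousAt_const (by simp)
    filter_upwards [h1, h2, self_mem_nhdsWithin] with ε hε1 hε2 hε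
    exact minimalDist_Omega_le hp2 hη0 (min_le_right _ _) hball' hε hε1 hε2.le
  have := hyp p hpΩ _ hq hzero
  have h0 := congrArg (fun v : EuclideanSpace ℝ (Fin 3) => v 0) this
  simp at h0
  exact hη0.ne' h0

end MinimalSurfaces

namespace MinimalSurfaces

/-! ### Harmonicity of linear coordinates on a minimal surface, in local coordinates -/

section PartialDerivatives

variable {E : Type*} [NormedAddCommGroup E] [InnerProductSpace ℝ E]
  {E' : Type*} [NormedAddCommGroup E'] [NormedSpace ℝ E'] {x : ℂ} {i : Fin 2}

theorem pderiv_congr {f g : ℂ → E'} (h : f =ᶠ[𝓝 x] g) : pderiv i f x = pderiv i g x := by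
  rw [pderiv, pderiv, h.fderiv_eq]

theorem pderiv_const (c : E') : pderiv i (fun _ => c) x = 0 := by
  simp [pderiv]

theorem pderiv_clm_comp {G : Type*} [NormedAddCommGroup G] [NormedSpace ℝ G] (l : E' →L[ℝ] G)
    {f : ℂ → E'} (hf : DifferentiableAt ℝ f x) :
    pderiv i (fun y => l (f y)) x = l (pderiv i f x) := by
  have := (l.hasFDerivAt.comp x hf.hasFDerivAt).fderiv
  simp only [pderiv]
  erw [this]
  rfl

theorem pderiv_inner {f g : ℂ → E} (hf : DifferentiableAt ℝ f x) (hg : DifferentiableAt ℝ g x) :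
    pderiv i (fun y => ⟪f y, g y⟫) x = ⟪f x, pderiv i g x⟫ + ⟪pderiv i f x, g x⟫ :=
  fderiv_inner_apply ℝ hf hg _

theorem pderiv_smul {c : ℂ → ℝ} {f : ℂ → E'} (hc : DifferentiableAt ℝ c x)
    (hf : DifferentiableAt ℝ f x) :
    pderiv i (fun y => c y • f y) x = c x • pderiv i f x + pderiv i c x • f x := by
  simp only [pderiv]
  rw [fderiv_fun_smul hc hf]
  simp

theorem pderiv_mul {c d : ℂ → ℝ} (hc : DifferentiableAt ℝ c x) (hd : DifferentiableAt ℝ d x) :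
    pderiv i (fun y => c y * d y) x = c x * pderiv i d x + pderiv i c x * d x :=
  pderiv_smul hc hd

theorem pderiv_sub {f g : ℂ → E'} (hf : DifferentiableAt ℝ f x) (hg : DifferentiableAt ℝ g x) :
    pderiv i (fun y => f y - g y) x = pderiv i f x - pderiv i g x := by
  simp only [pderiv]
  rw [fderiv_fun_sub hf hg]
  rfl

theorem differentiableAt_pderiv {F : ℂ → E'} (hF : ContDiffAt ℝ 2 F x) :
    DifferentiableAt ℝ (pderiv i F) x := by
  have h1 : ContDiffAt ℝ 1 (fderiv ℝ F) x := hF.fderiv_right (by norm_num)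
  exact (h1.differentiableAt one_ne_zero).clm_apply (differentiableAt_const _)

theorem pderiv_pderiv_comm {F : ℂ → E'} (hF : ContDiffAt ℝ 2 F x) (i j : Fin 2) :
    pderiv i (pderiv j F) x = pderiv j (pderiv i F) x := by
  have h1 : DifferentiableAt ℝ (fderiv ℝ F) x :=
    (hF.fderiv_right (m := 1) (by norm_num)).differentiableAt one_ne_zero
  have h2 : ∀ i j, pderiv i (pderiv j F) x =
      fderiv ℝ (fderiv ℝ F) x (planeBasis i) (planeBasis j) := by
    intro i j
    simp only [pderiv]
    change fderiv ℝ (fun y => fderiv ℝ F y (planeBasis j)) x (planeBasis i) = _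
    rw [fderiv_clm_apply h1 (differentiableAt_const _)]
    simp
  rw [h2, h2]
  exact hF.isSymmSndFDerivAt (by simp) _ _

theorem det_firstForm (F : ℂ → E) (y : ℂ) : (firstForm F y).det =
    ⟪pderiv 0 F y, pderiv 0 F y⟫ * ⟪pderiv 1 F y, pderiv 1 F y⟫ -
      ⟪pderiv 0 F y, pderiv 1 F y⟫ ^ 2 := by
  rw [Matrix.det_fin_two]
  simp only [firstForm, Matrix.of_apply]
  rw [real_inner_comm (pderiv 0 F y) (pderiv 1 F y)]
  ring

theorem firstForm_inv (F : ℂ → E) (y : ℂ) : (firstForm F y)⁻¹ = (firstForm F y).det⁻¹ •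
    !![⟪pderiv 1 F y, pderiv 1 F y⟫, -⟪pderiv 0 F y, pderiv 1 F y⟫;
      -⟪pderiv 0 F y, pderiv 1 F y⟫, ⟪pderiv 0 F y, pderiv 0 F y⟫] := by
  rw [Matrix.inv_def, Ring.inverse_eq_inv', Matrix.adjugate_fin_two]
  congr 1
  simp only [firstForm, Matrix.of_apply]
  rw [real_inner_comm (pderiv 0 F y) (pderiv 1 F y)]

theorem det_firstForm_pos {F : ℂ → E} {y : ℂ} (h : Function.Injective (fderiv ℝ F y)) :
    0 < (firstForm F y).det := by
  set T := fderiv ℝ F y with hT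
  have h0 : pderiv 0 F y = T 1 := rfl
  have h1 : pderiv 1 F y = T Complex.I := rfl
  have hb : 0 < ⟪T Complex.I, T Complex.I⟫ := by
    rw [real_inner_self_pos]
    intro h2
    exact Complex.I_ne_zero (h (h2.trans (map_zero T).symm))
  rw [det_firstForm, h0, h1]
  -- This is the Gram–Schmidt vector cleared of denominators: its squared length is `‖T I‖ ^ 2`
  -- times the determinant.
  have hv : T ((⟪T Complex.I, T Complex.I⟫ : ℂ) - ⟪T 1, T Complex.I⟫ * Complex.I) =
      ⟪T Complex.I, T Complex.I⟫ • T 1 - ⟪T 1, T Complex.I⟫ • T Complex.I := by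
    rw [← map_smul, ← map_smul, ← map_sub]
    simp
  have hpos : 0 < ⟪T ((⟪T Complex.I, T Complex.I⟫ : ℂ) - ⟪T 1, T Complex.I⟫ * Complex.I),
      T ((⟪T Complex.I, T Complex.I⟫ : ℂ) - ⟪T 1, T Complex.I⟫ * Complex.I)⟫ := by
    rw [real_inner_self_pos]
    intro h2
    have := congrArg Complex.re (h (h2.trans (map_zero T).symm))
    simp only [Complex.sub_re, Complex.ofReal_re, Complex.mul_re, Complex.I_re, mul_zero,
      Complex.ofReal_im, Complex.I_im, zero_mul, sub_zero, Complex.zero_re] at this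
    exact hb.ne' this
  rw [hv] at hpos
  simp only [inner_sub_left, inner_sub_right, real_inner_smul_left, real_inner_smul_right] at hpos
  rw [real_inner_comm (T 1) (T Complex.I)] at hpos
  refine pos_of_mul_pos_right (a := ⟪T Complex.I, T Complex.I⟫) ?_ hb.le
  linarith

/-- The two components of `√(det g) ∑ⱼ gⁱʲ ∂ⱼF`. -/
noncomputable def conjugateFrame (F : ℂ → E) (i : Fin 2) (y : ℂ) : E :=
  (Real.sqrt (firstForm F y).det)⁻¹ •
    (⟪pderiv (1 - i) F y, pderiv (1 - i) F y⟫ • pderiv i F y -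
      ⟪pderiv 0 F y, pderiv 1 F y⟫ • pderiv (1 - i) F y)

theorem sqrt_det_smul_conjugateFrame {F : ℂ → E} {y : ℂ} (h : 0 < (firstForm F y).det)
    (i : Fin 2) : Real.sqrt (firstForm F y).det • conjugateFrame F i y =
      ⟪pderiv (1 - i) F y, pderiv (1 - i) F y⟫ • pderiv i F y -
      ⟪pderiv 0 F y, pderiv 1 F y⟫ • pderiv (1 - i) F y := by
  rw [conjugateFrame, smul_inv_smul₀ (Real.sqrt_pos.2 h).ne']

/-- Up to the factor `√(det g)`, the conjugate frame is the basis of the tangent plane dual to the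
coordinate vectors. -/
theorem inner_conjugateFrame {F : ℂ → E} {y : ℂ} (h : 0 < (firstForm F y).det) (i j : Fin 2) :
    ⟪conjugateFrame F i y, pderiv j F y⟫ =
      if i = j then Real.sqrt (firstForm F y).det else 0 := by
  have hs := Real.sqrt_pos.2 h
  have hs2 := Real.mul_self_sqrt h.le
  refine mul_left_cancel₀ hs.ne' ?_
  rw [← real_inner_smul_left, sqrt_det_smul_conjugateFrame h]
  rw [mul_ite, hs2, mul_zero, det_firstForm]
  have hc := real_inner_comm (pderiv 0 F y) (pderiv 1 F y)
  have s0 : (1 : Fin 2) - 0 = 1 := rfl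
  have s1 : (1 : Fin 2) - 1 = 0 := rfl
  have h01 : ((0 : Fin 2) = 1) = False := by simp
  have h10 : ((1 : Fin 2) = 0) = False := by simp
  fin_cases i <;> fin_cases j <;>
    simp only [Fin.zero_eta, Fin.mk_one, Fin.isValue, inner_sub_left, real_inner_smul_left, s0, s1, h01, h10,
      if_true, if_false, hc] <;> ring

theorem differentiableAt_det_firstForm {F : ℂ → E} (hF : ContDiffAt ℝ 2 F x) :
    DifferentiableAt ℝ (fun y => (firstForm F y).det) x := by
  have ha : DifferentiableAt ℝ (pderiv 0 F) x := differentiableAt_pderiv hF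
  have hb : DifferentiableAt ℝ (pderiv 1 F) x := differentiableAt_pderiv hF
  simp only [det_firstForm]
  exact ((ha.inner ℝ ha).mul (hb.inner ℝ hb)).sub ((ha.inner ℝ hb).pow 2)

theorem differentiableAt_sqrt_det_firstForm {F : ℂ → E} (hF : ContDiffAt ℝ 2 F x)
    (h : 0 < (firstForm F x).det) :
    DifferentiableAt ℝ (fun y => Real.sqrt (firstForm F y).det) x :=
  (differentiableAt_det_firstForm hF).sqrt h.ne'

theorem eventually_det_firstForm_pos {F : ℂ → E} (hF : ContDiffAt ℝ 2 F x)
    (h : 0 < (firstForm F x).det) : ∀ᶠ y in 𝓝 x, 0 < (firstForm F y).det :=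
  continuousAt_const.eventually_lt (differentiableAt_det_firstForm hF).continuousAt h

theorem differentiableAt_conjugateFrame {F : ℂ → E} (hF : ContDiffAt ℝ 2 F x)
    (h : 0 < (firstForm F x).det) (i : Fin 2) : DifferentiableAt ℝ (conjugateFrame F i) x := by
  have ha : ∀ j, DifferentiableAt ℝ (pderiv j F) x := fun j => differentiableAt_pderiv hF
  exact ((differentiableAt_sqrt_det_firstForm hF h).inv (Real.sqrt_pos.2 h).ne').smul
    ((((ha _).inner ℝ (ha _)).smul (ha _)).sub (((ha _).inner ℝ (ha _)).smul (ha _)))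

/-- `∑ᵢ ∂ᵢ(√(det g) ∑ⱼ gⁱʲ ∂ⱼF)` is orthogonal to the tangent vectors of an immersion `F`. -/
theorem inner_div_conjugateFrame {F : ℂ → E} (hF : ContDiffAt ℝ 2 F x)
    (h : 0 < (firstForm F x).det) (j : Fin 2) :
    ⟪pderiv 0 (conjugateFrame F 0) x + pderiv 1 (conjugateFrame F 1) x, pderiv j F x⟫ = 0 := by
  have ha : ∀ j, DifferentiableAt ℝ (pderiv j F) x := fun j => differentiableAt_pderiv hF
  have hA := differentiableAt_conjugateFrame hF h
  have hS := differentiableAt_sqrt_det_firstForm hF h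
  have hs := Real.sqrt_pos.2 h
  have hcomm : pderiv 1 (pderiv 0 F) x = pderiv 0 (pderiv 1 F) x := pderiv_pderiv_comm hF 1 0
  have hdet := eventually_det_firstForm_pos hF h
  have hW : ∀ i, 2 * (Real.sqrt (firstForm F x).det *
      pderiv i (fun y => Real.sqrt (firstForm F y).det) x) =
      pderiv i (fun y => (firstForm F y).det) x := by
    intro i
    have e : (fun y => (firstForm F y).det) =ᶠ[𝓝 x]
        fun y => Real.sqrt (firstForm F y).det * Real.sqrt (firstForm F y).det := by
      filter_upwards [hdet] with y hy using (Real.mul_self_sqrt hy.le).symm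
    rw [pderiv_congr e, pderiv_mul hS hS]
    ring
  have hW' : ∀ i, pderiv i (fun y => (firstForm F y).det) x =
      2 * (⟪pderiv 0 F x, pderiv i (pderiv 0 F) x⟫ * ⟪pderiv 1 F x, pderiv 1 F x⟫ +
        ⟪pderiv 0 F x, pderiv 0 F x⟫ * ⟪pderiv 1 F x, pderiv i (pderiv 1 F) x⟫ -
        ⟪pderiv 0 F x, pderiv 1 F x⟫ * (⟪pderiv 0 F x, pderiv i (pderiv 1 F) x⟫ +
          ⟪pderiv 1 F x, pderiv i (pderiv 0 F) x⟫)) := by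
    intro i
    have e : (fun y => (firstForm F y).det) = fun y =>
        ⟪pderiv 0 F y, pderiv 0 F y⟫ * ⟪pderiv 1 F y, pderiv 1 F y⟫ -
          ⟪pderiv 0 F y, pderiv 1 F y⟫ * ⟪pderiv 0 F y, pderiv 1 F y⟫ := by
      funext y; rw [det_firstForm, sq]
    have d00 := (ha 0).inner ℝ (ha 0)
    have d01 := (ha 0).inner ℝ (ha 1)
    have d11 := (ha 1).inner ℝ (ha 1)
    rw [e, pderiv_sub (d00.fun_mul d11) (d01.fun_mul d01), pderiv_mul d00 d11, pderiv_mul d01 d01,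
      pderiv_inner (ha 0) (ha 0), pderiv_inner (ha 0) (ha 1), pderiv_inner (ha 1) (ha 1),
      real_inner_comm (pderiv 0 F x) (pderiv i (pderiv 0 F) x),
      real_inner_comm (pderiv 1 F x) (pderiv i (pderiv 0 F) x),
      real_inner_comm (pderiv 1 F x) (pderiv i (pderiv 1 F) x)]
    ring
  -- By duality the differentiated products sum to `∂ⱼ √(det g)`. The correction terms `⟪Aⁱ, ∂ᵢ∂ⱼF⟫`
  -- sum to the same quantity by symmetry of second derivatives and the formula for the derivative
  -- of the determinant.
  have hprod : ∀ i k, ⟪pderiv k (conjugateFrame F i) x, pderiv j F x⟫ =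
      pderiv k (fun y => ⟪conjugateFrame F i y, pderiv j F y⟫) x -
        ⟪conjugateFrame F i x, pderiv k (pderiv j F) x⟫ := by
    intro i k
    rw [pderiv_inner (hA i) (ha j)]
    ring
  have hzero : ∀ i k, i ≠ j →
      pderiv k (fun y => ⟪conjugateFrame F i y, pderiv j F y⟫) x = 0 := by
    intro i k hij
    have e : (fun y => ⟪conjugateFrame F i y, pderiv j F y⟫) =ᶠ[𝓝 x] fun _ => (0 : ℝ) := by
      filter_upwards [hdet] with y hy
      rw [inner_conjugateFrame hy, if_neg hij]
    rw [pderiv_congr e, pderiv_const]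
  have hdiag : ∀ i k, i = j → pderiv k (fun y => ⟪conjugateFrame F i y, pderiv j F y⟫) x =
      pderiv k (fun y => Real.sqrt (firstForm F y).det) x := by
    intro i k hij
    refine pderiv_congr ?_
    filter_upwards [hdet] with y hy
    rw [inner_conjugateFrame hy, if_pos hij]
  have hsA : ∀ i v, Real.sqrt (firstForm F x).det * ⟪conjugateFrame F i x, v⟫ =
      ⟪pderiv (1 - i) F x, pderiv (1 - i) F x⟫ * ⟪pderiv i F x, v⟫ -
        ⟪pderiv 0 F x, pderiv 1 F x⟫ * ⟪pderiv (1 - i) F x, v⟫ := by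
    intro i v
    rw [← real_inner_smul_left, sqrt_det_smul_conjugateFrame h, inner_sub_left,
      real_inner_smul_left, real_inner_smul_left]
  refine mul_left_cancel₀ hs.ne' ?_
  rw [mul_zero, inner_add_left, hprod, hprod, mul_add, mul_sub, mul_sub, hsA, hsA]
  have s0 : (1 : Fin 2) - 0 = 1 := rfl
  have s1 : (1 : Fin 2) - 1 = 0 := rfl
  rw [s0, s1]
  have hW0 := hW 0
  have hW1 := hW 1
  rw [hW'] at hW0 hW1
  fin_cases j
  · simp only [Fin.zero_eta] at *
    rw [hdiag 0 0 rfl, hzero 1 1 (by decide), hcomm]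
    linarith
  · simp only [Fin.mk_one] at *
    rw [hdiag 1 1 rfl, hzero 0 0 (by decide)]
    rw [hcomm] at hW1
    linarith

/-- The divergence `V` is normal by `inner_div_conjugateFrame`, so `V` itself may be the test normal
in the mean curvature condition. Since `V` is orthogonal to all tangent vectors, terms in which a
coefficient is differentiated drop out, and `⟪V, V⟫` becomes a multiple of the traced second
fundamental form. -/
theorem div_conjugateFrame_eq_zero {F : ℂ → E} (hF : ContDiffAt ℝ 2 F x)
    (h : 0 < (firstForm F x).det) (hmin : MeanCurvatureVanishesAt F x) :
    pderiv 0 (conjugateFrame F 0) x + pderiv 1 (conjugateFrame F 1) x = 0 := by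
  set V := pderiv 0 (conjugateFrame F 0) x + pderiv 1 (conjugateFrame F 1) x with hV
  have hVt : ∀ j, ⟪pderiv j F x, V⟫ = 0 := fun j => by
    rw [real_inner_comm]; exact inner_div_conjugateFrame hF h j
  have ha : ∀ j, DifferentiableAt ℝ (pderiv j F) x := fun j => differentiableAt_pderiv hF
  have hA := differentiableAt_conjugateFrame hF h
  have hS := differentiableAt_sqrt_det_firstForm hF h
  have hs := Real.sqrt_pos.2 h
  have hdet := eventually_det_firstForm_pos hF h
  have hAV : ∀ i, ⟪conjugateFrame F i x, V⟫ = 0 := by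
    intro i
    rw [conjugateFrame, real_inner_smul_left, inner_sub_left, real_inner_smul_left,
      real_inner_smul_left, hVt, hVt]
    simp
  have key : ∀ i, Real.sqrt (firstForm F x).det * ⟪pderiv i (conjugateFrame F i) x, V⟫ =
      ⟪pderiv (1 - i) F x, pderiv (1 - i) F x⟫ * ⟪pderiv i (pderiv i F) x, V⟫ -
        ⟪pderiv 0 F x, pderiv 1 F x⟫ * ⟪pderiv i (pderiv (1 - i) F) x, V⟫ := by
    intro i
    have e : (fun y => Real.sqrt (firstForm F y).det • conjugateFrame F i y) =ᶠ[𝓝 x]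
        fun y => ⟪pderiv (1 - i) F y, pderiv (1 - i) F y⟫ • pderiv i F y -
          ⟪pderiv 0 F y, pderiv 1 F y⟫ • pderiv (1 - i) F y := by
      filter_upwards [hdet] with y hy using sqrt_det_smul_conjugateFrame hy i
    have e2 := pderiv_congr (i := i) e
    rw [pderiv_smul hS (hA i), pderiv_sub (((ha _).inner ℝ (ha _)).fun_smul (ha _))
      (((ha _).inner ℝ (ha _)).fun_smul (ha _)), pderiv_smul ((ha _).inner ℝ (ha _)) (ha _),
      pderiv_smul ((ha _).inner ℝ (ha _)) (ha _)] at e2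
    have e3 := congrArg (fun v => ⟪v, V⟫) e2
    simpa only [inner_add_left, inner_sub_left, real_inner_smul_left, hAV, hVt, mul_zero,
      add_zero] using e3
  have hVV : Real.sqrt (firstForm F x).det * ⟪V, V⟫ = 0 := by
    have h1 := hmin V hVt
    rw [firstForm_inv] at h1
    simp only [Fin.sum_univ_two, Matrix.smul_apply, Matrix.of_apply, Matrix.cons_val_zero,
      Matrix.cons_val_one, Matrix.cons_val', Matrix.cons_val_fin_one, smul_eq_mul] at h1
    have h2 : (firstForm F x).det⁻¹ *
        (Real.sqrt (firstForm F x).det * ⟪V, V⟫) = 0 := by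
      rw [← h1]
      have k0 := key 0
      have k1 := key 1
      have s0 : (1 : Fin 2) - 0 = 1 := rfl
      have s1 : (1 : Fin 2) - 1 = 0 := rfl
      rw [s0] at k0
      rw [s1] at k1
      have : ⟪V, V⟫ = ⟪pderiv 0 (conjugateFrame F 0) x, V⟫ +
          ⟪pderiv 1 (conjugateFrame F 1) x, V⟫ := by
        rw [← inner_add_left]
      rw [this, mul_add, k0, k1]
      ring
    exact (mul_eq_zero.1 h2).resolve_left (inv_ne_zero h.ne')
  exact inner_self_eq_zero.1 ((mul_eq_zero.1 hVV).resolve_left hs.ne')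

/-- Affine functions are harmonic on a minimal surface. -/
theorem laplaceBeltrami_firstForm_eq_zero {F : ℂ → E} (hF : ContDiffAt ℝ 2 F x)
    (h : 0 < (firstForm F x).det) (hmin : MeanCurvatureVanishesAt F x) (l : E →L[ℝ] ℝ) (c : ℝ) :
    laplaceBeltrami (firstForm F) (fun y => l (F y) - c) x = 0 := by
  have hdiff : ∀ᶠ y in 𝓝 x, DifferentiableAt ℝ F y :=
    (hF.eventually (by simp)).mono fun y hy => hy.differentiableAt two_ne_zero
  have hdet := eventually_det_firstForm_pos hF h
  have hA := differentiableAt_conjugateFrame hF h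
  have hu : ∀ y, DifferentiableAt ℝ F y → ∀ j,
      pderiv j (fun y => l (F y) - c) y = l (pderiv j F y) := by
    intro y hy j
    rw [← pderiv_clm_comp l hy]
    simp only [pderiv]
    rw [fderiv_sub_const]
  -- The flux of a linear coordinate is the functional applied to `conjugateFrame`, so its Laplacian
  -- is the functional applied to the vanishing divergence.
  have hflux : ∀ i, (fun y => Real.sqrt (firstForm F y).det *
      ∑ j, (firstForm F y)⁻¹ i j * pderiv j (fun y => l (F y) - c) y) =ᶠ[𝓝 x]
      fun y => l (conjugateFrame F i y) := by
    intro i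
    filter_upwards [hdiff, hdet] with y hy hy'
    have hs := Real.sqrt_pos.2 hy'
    have hinv : (Real.sqrt (firstForm F y).det)⁻¹ =
        Real.sqrt (firstForm F y).det * (firstForm F y).det⁻¹ := by
      nth_rw 3 [← Real.mul_self_sqrt hy'.le]
      field_simp
    simp only [hu y hy]
    rw [conjugateFrame, map_smul, map_sub, map_smul, map_smul, firstForm_inv, hinv]
    fin_cases i <;> simp [Fin.sum_univ_two] <;> ring
  rw [laplaceBeltrami, Fin.sum_univ_two, pderiv_congr (hflux 0), pderiv_congr (hflux 1),
    pderiv_clm_comp l (hA 0), pderiv_clm_comp l (hA 1), ← map_add,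
    div_conjugateFrame_eq_zero hF h hmin, map_zero, mul_zero]

end PartialDerivatives

/-! ### Parabolic minimal surfaces have no nonconstant coordinate bounded above -/

section Surface

variable {R : Type*} [TopologicalSpace R] [ChartedSpace ℂ R]
  {E : Type*} [NormedAddCommGroup E] [InnerProductSpace ℝ E]

theorem contDiffAt_inChart [IsManifold 𝓘(ℝ, ℂ) ∞ R] {f : R → E} (hf : ContMDiff 𝓘(ℝ, ℂ) 𝓘(ℝ, E) ∞ f) (p : R) :
    ContDiffAt ℝ ∞ (inChart p f) (chartAt ℂ p p) := by
  rw [← contMDiffAt_iff_contDiffAt]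
  have h1 : ContMDiffAt 𝓘(ℝ, ℂ) 𝓘(ℝ, ℂ) ∞ (chartAt ℂ p).symm (chartAt ℂ p p) :=
    (contMDiffOn_chart_symm (x := p)).contMDiffAt (chart_target_mem_nhds ℂ p)
  exact (hf _).comp _ h1

theorem mfderiv_eq_fderiv_inChart {f : R → E} {p : R}
    (hf : MDifferentiableAt 𝓘(ℝ, ℂ) 𝓘(ℝ, E) f p) :
    mfderiv 𝓘(ℝ, ℂ) 𝓘(ℝ, E) f p = fderiv ℝ (inChart p f) (chartAt ℂ p p) := by
  rw [hf.mfderiv]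
  simp only [mfld_simps, fderivWithin_univ]
  rfl

theorem IsMinimalImmersion.inducedLaplacian_eq_zero [IsManifold 𝓘(ℝ, ℂ) ∞ R] {f : R → E}
    (hf : IsMinimalImmersion f) (l : E →L[ℝ] ℝ) (c : ℝ) (p : R) : inducedLaplacian f (fun q => l (f q) - c) p = 0 := by
  refine laplaceBeltrami_firstForm_eq_zero (F := inChart p f)
    ((contDiffAt_inChart hf.smooth p).of_le (by norm_cast))
    (det_firstForm_pos ?_) (hf.minimal p) l c
  have := hf.immersion p
  rwa [mfderiv_eq_fderiv_inChart ((hf.smooth p).mdifferentiableAt (by simp))] at this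

theorem isConst_of_isParabolicImmersion [IsManifold 𝓘(ℝ, ℂ) ∞ R] {f : R → E}
    (hf : IsMinimalImmersion f) (hp : IsParabolicImmersion f) (l : E →L[ℝ] ℝ) {C : ℝ} (hC : ∀ p, l (f p) ≤ C) (p q : R) :
    l (f p) = l (f q) := by
  -- The extra `1` makes the function strictly negative even where the bound `C` is attained.
  obtain ⟨c, hc⟩ := hp (fun q => l (f q) - (C + 1))
    (by
      have h1 : ContMDiff 𝓘(ℝ, E) 𝓘(ℝ, ℝ) ∞ fun v : E => l v - (C + 1) :=
        ContDiff.contMDiff (by fun_prop)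
      exact (h1.comp hf.smooth).of_le (by norm_cast))
    (fun p => by linarith [hC p])
    (fun p => (hf.inducedLaplacian_eq_zero l (C + 1) p).ge)
  linarith [hc p, hc q]

end Surface

/-- The slicing argument with parabolicity in place of Liouville. Boundedness of `D` handles the
slice at height zero, and a constant map has zero differential. -/
theorem not_containsParabolicMinimalSurface_Omega {D : TopologicalSpace.Opens ℂ}
    (hD : Bornology.IsBounded (D : Set ℂ)) : ¬ ContainsParabolicMinimalSurface.{u} (Omega D) := by
  rintro ⟨R, _, _, _, _, _, _, f, hf, hpar, hΩ⟩
  obtain ⟨r₀⟩ := (inferInstance : Nonempty R)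
  have coord : ∀ (i : Fin 3) (C : ℝ), (∀ p, f p i ≤ C) → ∀ p, f p i = f r₀ i :=
    fun i C hC p => isConst_of_isParabolicImmersion hf hpar (EuclideanSpace.proj i) hC p r₀
  have h2 := coord 2 1 fun p => (abs_lt.1 (hΩ p).1).2.le
  have h01 : ∀ i : Fin 3, i ≠ 2 → ∀ p, f p i = f r₀ i := by
    intro i hi
    by_cases hc : f r₀ 2 = 0
    · obtain ⟨C, hC⟩ := hD.exists_norm_le
      refine coord i C fun p => ?_
      have := hC _ ((hΩ p).2.2 (by rw [h2, hc]))
      fin_cases i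
      · exact ((Complex.re_le_norm _).trans this)
      · exact ((Complex.im_le_norm _).trans this)
      · exact absurd rfl hi
    · refine coord i (1 / |f r₀ 2|) fun p => ?_
      have := abs_coord_le_of_mem_Omega (hΩ p) (by rwa [h2]) hi
      rw [h2] at this
      exact (le_abs_self _).trans this
  have hconst : f = fun _ => f r₀ := by
    funext p
    ext i
    by_cases hi : i = 2
    · rw [hi]; exact h2 p
    · exact h01 i hi p
  have hinj := hf.immersion r₀
  rw [hconst, mfderiv_const] at hinj
  exact one_ne_zero (α := ℂ) (hinj rfl)

/-! ### `D × {0}` is a proper minimal surface -/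

/-- The inclusion of the plane `z = 0` in the space. -/
noncomputable def planeInclusion : ℂ →L[ℝ] EuclideanSpace ℝ (Fin 3) :=
  Complex.reCLM.smulRight (EuclideanSpace.single 0 1) +
    Complex.imCLM.smulRight (EuclideanSpace.single 1 1)

theorem horizontalInclusion_eq (D : TopologicalSpace.Opens ℂ) :
    horizontalInclusion D = fun z : D => planeInclusion (z : ℂ) := by
  funext z
  ext i
  fin_cases i <;> simp [horizontalInclusion, planeInclusion]

theorem planeInclusion_injective : Function.Injective planeInclusion := by
  intro z w h
  have h0 := congrArg (fun v : EuclideanSpace ℝ (Fin 3) => v 0) h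
  have h1 := congrArg (fun v : EuclideanSpace ℝ (Fin 3) => v 1) h
  simp [planeInclusion] at h0 h1
  exact Complex.ext h0 h1

theorem inChart_horizontalInclusion {D : TopologicalSpace.Opens ℂ} (z : D) :
    inChart z (horizontalInclusion D) =ᶠ[𝓝 (chartAt ℂ z z)] planeInclusion := by
  rw [horizontalInclusion_eq]
  filter_upwards [chart_target_mem_nhds ℂ z] with w hw
  have h1 : (chartAt ℂ z) ((chartAt ℂ z).symm w) = w := (chartAt ℂ z).right_inv hw
  have h2 : ∀ y : D, (chartAt ℂ z) y = (y : ℂ) := fun y => rfl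
  rw [h2] at h1
  simp only [inChart, h1]

theorem isMinimalImmersion_horizontalInclusion (D : TopologicalSpace.Opens ℂ) :
    IsMinimalImmersion (horizontalInclusion D) := by
  have hsmooth : ContMDiff 𝓘(ℝ, ℂ) 𝓘(ℝ, EuclideanSpace ℝ (Fin 3)) ∞ (horizontalInclusion D) := by
    rw [horizontalInclusion_eq]
    exact planeInclusion.contDiff.contMDiff.comp contMDiff_subtype_val
  refine ⟨hsmooth, fun p => ?_, fun p N _ => ?_⟩
  · rw [mfderiv_eq_fderiv_inChart ((hsmooth p).mdifferentiableAt (by simp)),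
      (inChart_horizontalInclusion p).fderiv_eq, planeInclusion.fderiv]
    exact planeInclusion_injective
  · have h : ∀ i j, pderiv i (pderiv j (inChart p (horizontalInclusion D)))
        (chartAt ℂ p p) = 0 := by
      intro i j
      have e : pderiv j (inChart p (horizontalInclusion D)) =ᶠ[𝓝 (chartAt ℂ p p)]
          fun _ => planeInclusion (planeBasis j) := by
        filter_upwards [(inChart_horizontalInclusion p).eventuallyEq_nhds] with y hy
        rw [pderiv_congr hy, pderiv, planeInclusion.fderiv]
      rw [pderiv_congr e, pderiv_const]
    simp [h]

/-- Properness holds because the inclusion is a closed embedding: projection to the plane is a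
continuous left inverse, and the image is the whole slice `z = 0`, closed in `Omega D`. -/
theorem isProperMinimalSurfaceIn_horizontalInclusion (D : TopologicalSpace.Opens ℂ) :
    IsProperMinimalSurfaceIn (horizontalInclusion D) (Omega D) := by
  have hmem : ∀ p, horizontalInclusion D p ∈ Omega D := fun p =>
    ⟨by simp [horizontalInclusion], by simp [horizontalInclusion],
      fun _ => by simp [horizontalInclusion]⟩
  refine ⟨isMinimalImmersion_horizontalInclusion D, hmem, ?_⟩
  refine Topology.IsClosedEmbedding.isProperMap ?_
  have hcont : Continuous (horizontalInclusion D) := by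
    rw [horizontalInclusion_eq]
    exact planeInclusion.continuous.comp continuous_subtype_val
  have hproj : Continuous fun v : EuclideanSpace ℝ (Fin 3) => (v 0 : ℂ) + v 1 * Complex.I := by
    fun_prop
  have hleft : ∀ p : D, ((horizontalInclusion D p 0 : ℝ) : ℂ) +
      (horizontalInclusion D p 1 : ℝ) * Complex.I = p := fun p => by
    simp [horizontalInclusion, Complex.re_add_im]
  refine ⟨⟨?_, ?_⟩, ?_⟩
  · refine Topology.IsInducing.of_comp (hcont.subtype_mk _)
      (g := fun v : Omega D => ((v : EuclideanSpace ℝ (Fin 3)) 0 : ℂ) +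
        (v : EuclideanSpace ℝ (Fin 3)) 1 * Complex.I)
      (hproj.comp continuous_subtype_val) ?_
    have : ((fun v : Omega D => ((v : EuclideanSpace ℝ (Fin 3)) 0 : ℂ) +
        (v : EuclideanSpace ℝ (Fin 3)) 1 * Complex.I) ∘
        fun p => (⟨horizontalInclusion D p, hmem p⟩ : Omega D)) = Subtype.val :=
      funext hleft
    rw [this]
    exact Topology.IsInducing.subtypeVal
  · intro p q h
    have h1 := congrArg Subtype.val h
    simp only at h1
    exact Subtype.ext (by rw [← hleft p, ← hleft q, h1])
  · have : range (fun p => (⟨horizontalInclusion D p, hmem p⟩ : Omega D)) =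
        {v : Omega D | (v : EuclideanSpace ℝ (Fin 3)) 2 = 0} := by
      ext v
      constructor
      · rintro ⟨p, rfl⟩
        simp [horizontalInclusion]
      · intro hv
        refine ⟨⟨_, v.2.2.2 hv⟩, Subtype.ext ?_⟩
        ext i
        fin_cases i
        · rfl
        · rfl
        · exact (Eq.symm hv)
    rw [this]
    exact isClosed_eq (by fun_prop) continuous_const

end MinimalSurfaces

theorem proposition4p2 :
    -- (a)
    (∃ Ω : Set (EuclideanSpace ℝ (Fin 3)), IsDomainSet Ω ∧ ¬ IsHyperbolic Ω ∧
      ¬ ContainsParabolicMinimalSurface.{u} Ω) ∧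
    -- (b)
    (∃ Ω : Set (EuclideanSpace ℝ (Fin 3)), IsDomainSet Ω ∧ IsWeaklyHyperbolic Ω ∧
      ¬ IsHyperbolic Ω) ∧
    -- (c)
    (∀ D : TopologicalSpace.Opens ℂ, IsParabolicPlaneDomain D →
      (∃ a b : ℂ, a ≠ b ∧ a ∉ D ∧ b ∉ D) →
      IsDomainSet (Omega D) ∧ IsWeaklyHyperbolic (Omega D) ∧ ¬ IsHyperbolic (Omega D) ∧
        IsProperMinimalSurfaceIn (horizontalInclusion D) (Omega D)) := by
  set B : TopologicalSpace.Opens ℂ := ⟨Metric.ball 0 1, Metric.isOpen_ball⟩ with hB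
  have hBne : (B : Set ℂ).Nonempty := ⟨0, Metric.mem_ball_self one_pos⟩
  have hBdom : IsDomainSet (Omega B) := ⟨isOpen_Omega B, isConnected_Omega hBne⟩
  have hBmem : ∀ w : ℂ, w ∈ B ↔ ‖w‖ < 1 := fun w => by
    rw [← SetLike.mem_coe, hB]; simp
  refine ⟨⟨Omega B, hBdom, not_isHyperbolic_Omega hBne,
    not_containsParabolicMinimalSurface_Omega Metric.isBounded_ball⟩,
    ⟨Omega B, hBdom, isWeaklyHyperbolic_Omega (a := 1) (b := 2) (by norm_num)
      (by simp [hBmem]) (by simp [hBmem]), not_isHyperbolic_Omega hBne⟩, ?_⟩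
  rintro D ⟨hD, -⟩ ⟨a, b, hab, ha, hb⟩
  exact ⟨⟨isOpen_Omega D, isConnected_Omega hD.nonempty⟩, isWeaklyHyperbolic_Omega hab ha hb,
    not_isHyperbolic_Omega hD.nonempty, isProperMinimalSurfaceIn_horizontalInclusion D⟩
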